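/- Let $T$ be a closed oriented 3-dimensional triangulation, that is, a complex obtained from a finite set of tetrahedra by gluing all their triangles two by two through orientation-reversing simplicial maps, no triangle being glued to itself (two triangles of the same tetrahedron may be glued; simplices of $T$ may share several faces, and edges and vertices of the tetrahedra are identified exactly as forced by the gluing of the triangles). Let $T_0$ be a spanning tree of tetrahedra of $T$, that is, all the tetrahedra of $T$ glued only along a set $S$ of triangles of $T$ dual to the edges of a spanning tree of the dual graph of $T$. Let $T^{T_0}$ be the 2-complex that consists of all the vertices and edges of $T$ and of the triangles of $T$ that are not in $S$. A local construction of $T$ based on $T_0$ is a sequence of complexes $T_0, T_1,\ldots,T_n=T$ such that, for each $s$, $T_{s+1}$ is obtained from $T_s$ by choosing an edge $e_{s+1}$ of $T_s$ shared by two distinct boundary triangles $A_{s+1},B_{s+1}$ of $T_s$ and gluing these two triangles by the simplicial map that is the identity on $e_{s+1}$; the chosen edges are part of the data (they matter when $A_{s+1}$ and $B_{s+1}$ share more than one edge). An elementary collapse of a complex $C$ removes from $C$ a simplex $\Sigma$ of some dimension $k$ and a $(k-1)$-simplex $\sigma$ that occurs exactly once among the faces of $\Sigma$ and is contained in no other simplex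 of $C$ of dimension at least $k$. A collapsing sequence of $T^{T_0}$ onto a subcomplex $E$ is a finite sequence of elementary collapses (the pairs $(\sigma_s,\Sigma_s)$ being part of the data) that starts from $T^{T_0}$ and ends with $E$. A spanning tree of edges of $T$ is a spanning tree of the 1-skeleton of $T$, seen as a 1-complex containing all the vertices of $T$. Then there is a bijection between - the local constructions of $T$ based on $T_0$, and - the collapsing sequences of $T^{T_0}$ onto $E$, where $E$ is any spanning tree of edges of $T$ ($E$ is not fixed). Moreover the bijection can be taken such that a local construction and the corresponding collapsing sequence have the same number of steps, and for each $s$ the $s$-th collapse removes the triangle $\Sigma_s$ of $T$ that results from the gluing of $A_s$ and $B_s$, together with the edge $\sigma_s$ of $T$ that is the image of the chosen edge $e_s$. -/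

import Mathlib

/-- An oriented gluing of tetrahedra along triangles. `K` is the set of tetrahedra; the vertices of
each tetrahedron are labelled by `Fin 4` (compatibly with its orientation), and its triangle number
`i` is the one opposite to vertex `i`. The value `adj t i = none` says that triangle `i` of `t` is
on the boundary; `adj t i = some (t', p)` says that it is glued to triangle `p i` of `t'`, each
vertex `j ≠ i` of `t` being glued to the vertex `p j` of `t'`. No triangle is glued to itself, and
the gluing maps reverse orientations. -/
@[ext]
structure TetGluing (K : Type*) where
  adj : K → Fin 4 → Option (K × Equiv.Perm (Fin 4))
  adj_symm : ∀ t i t' p, adj t i = some (t', p) → adj t' (p i) = some (t, p⁻¹)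
  adj_irrefl : ∀ t i p, adj t i = some (t, p) → p i ≠ i
  adj_sign : ∀ t i t' p, adj t i = some (t', p) → Equiv.Perm.sign p = -1

/-- A simplex of one of the tetrahedra, before gluing: a tetrahedron and a non-empty set of its
vertices. -/
@[ext]
structure LocalSimplex (K : Type*) where
  tet : K
  verts : Finset (Fin 4)
  nonempty : verts.Nonempty

namespace TetGluing

variable {K : Type*}

/-- The closed three-dimensional triangulations: no boundary triangle is left. -/
def IsClosed (G : TetGluing K) : Prop := ∀ t i, G.adj t i ≠ none

/-- `G.Carries A t t' p`: one can go from the tetrahedron `t` to the tetrahedron `t'` by crossing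
successively glued triangles that all contain the simplex of `t` with vertex set `A`, and the
composition of the gluing maps is `p`. In the glued complex, this simplex of `t` is therefore
identified with the simplex of `t'` with vertex set `p '' A`, vertex `a` with vertex `p a`. -/
inductive Carries (G : TetGluing K) (A : Finset (Fin 4)) (t : K) :
    K → Equiv.Perm (Fin 4) → Prop
  | refl : Carries G A t t 1
  | cross {t' t'' : K} {p q : Equiv.Perm (Fin 4)} {i : Fin 4} :
      Carries G A t t' p → (∀ a ∈ A, p a ≠ i) → G.adj t' i = some (t'', q) →
        Carries G A t t'' (q * p)

theorem Carries.trans {G : TetGluing K} {A : Finset (Fin 4)} {t t' t'' : K}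
    {p q : Equiv.Perm (Fin 4)} (h : G.Carries A t t' p)
    (h' : G.Carries (A.map p.toEmbedding) t' t'' q) : G.Carries A t t'' (q * p) := by
  induction h' with
  | refl => simpa using h
  | cross _ ha hadj ih =>
    rw [mul_assoc]
    refine ih.cross (fun a haA => ?_) hadj
    exact ha (p a) (Finset.mem_map_of_mem _ haA)

theorem Carries.symm {G : TetGluing K} {A : Finset (Fin 4)} {t t' : K}
    {p : Equiv.Perm (Fin 4)} (h : G.Carries A t t' p) :
    G.Carries (A.map p.toEmbedding) t' t p⁻¹ := by
  induction h with
  | refl => simpa using Carries.refl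
  | @cross t' t'' p q i _ ha hadj ih =>
    rw [mul_inv_rev]
    have hmap : (A.map (q * p).toEmbedding).map (q⁻¹).toEmbedding = A.map p.toEmbedding := by
      ext x
      simp only [Finset.mem_map_equiv]
      change p.symm (q.symm (q x)) ∈ A ↔ p.symm x ∈ A
      simp
    refine Carries.trans (q := p⁻¹) (p := q⁻¹) (t' := t') ?_ (by rw [hmap]; exact ih)
    have := Carries.cross (G := G) (A := A.map (q * p).toEmbedding) (t := t'')
      (i := q i) (q := q⁻¹) (t'' := t') Carries.refl (by
        intro a haA
        obtain ⟨b, hb, rfl⟩ := Finset.mem_map.1 haA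
        simpa using ha b hb) (G.adj_symm _ _ _ _ hadj)
    simpa using this

/-- Two simplices of tetrahedra are identified in the glued complex. -/
def simplexSetoid (G : TetGluing K) : Setoid (LocalSimplex K) where
  r x y := ∃ p, G.Carries x.verts x.tet y.tet p ∧ x.verts.map p.toEmbedding = y.verts
  iseqv :=
    { refl := fun _ => ⟨1, Carries.refl, by ext; simp only [Finset.mem_map_equiv]; exact Iff.rfl⟩
      symm := by
        rintro x y ⟨p, hp, hxy⟩
        refine ⟨p⁻¹, hxy ▸ hp.symm, ?_⟩
        rw [← hxy]; ext a
        simp only [Finset.mem_map_equiv]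
        change p.symm (p a) ∈ x.verts ↔ a ∈ x.verts
        simp
      trans := by
        rintro x y z ⟨p, hp, hxy⟩ ⟨q, hq, hyz⟩
        refine ⟨q * p, hp.trans (hxy.symm ▸ hq), ?_⟩
        rw [← hyz, ← hxy]; ext; simp only [Finset.mem_map_equiv]; exact Iff.rfl }

/-- The simplices (of dimensions 0 to 3) of the complex obtained by gluing. -/
def Simplex (G : TetGluing K) : Type _ := Quotient G.simplexSetoid

/-- The simplex of the glued complex that is the image of a simplex of a tetrahedron. -/
def image (G : TetGluing K) (x : LocalSimplex K) : G.Simplex := Quotient.mk G.simplexSetoid x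

def Simplex.dim {G : TetGluing K} : G.Simplex → ℕ :=
  Quotient.lift (fun x : LocalSimplex K => x.verts.card - 1) (by
    rintro x y ⟨p, -, hxy⟩
    simp [← hxy])

/-- The vertex `a` of the tetrahedron `t`. -/
def localVertex (t : K) (a : Fin 4) : LocalSimplex K := ⟨t, {a}, by simp⟩

/-- The edge (for `a ≠ b`) of the tetrahedron `t` with endpoints `a` and `b`. -/
def localEdge (t : K) (a b : Fin 4) : LocalSimplex K := ⟨t, {a, b}, by simp⟩

/-- The triangle of the tetrahedron `t` opposite to its vertex `i`. -/
def localTriangle (t : K) (i : Fin 4) : LocalSimplex K :=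
  ⟨t, {i}ᶜ, ⟨i + 1, by simp⟩⟩

theorem image_localTriangle_eq (G : TetGluing K) {t t' : K} {i : Fin 4} {p : Equiv.Perm (Fin 4)}
    (h : G.adj t i = some (t', p)) : G.image (localTriangle t i) = G.image (localTriangle t' (p i)) := by
  refine Quotient.sound ⟨p, ?_, ?_⟩
  · have := Carries.cross (G := G) (A := {i}ᶜ) (t := t) (i := i) Carries.refl (by simp) h
    simpa [localTriangle] using this
  · ext x
    simp only [localTriangle, Finset.mem_map_equiv, Finset.mem_compl, Finset.mem_singleton]
    rw [Equiv.symm_apply_eq]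

end TetGluing

/-- In the multigraph with vertex set `V` and edge set `E`, where `joins e u v` says that `u` and
`v` are the two ends of the edge `e`, the set `S` of edges is a spanning tree: it contains neither
loops nor multiple edges, and the simple graph on `V` that it defines is a tree. -/
structure IsSpanningTreeOf {V E : Type*} (joins : E → V → V → Prop) (S : Set E) : Prop where
  loopless : ∀ e ∈ S, ∀ v, ¬ joins e v v
  noMultiple : ∀ e ∈ S, ∀ e' ∈ S, ∀ u v, joins e u v → joins e' u v → e = e'
  isTree : (SimpleGraph.fromRel fun u v => ∃ e ∈ S, joins e u v).IsTree

namespace TetGluing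

variable {K : Type*}

/-- The dual graph: the interior triangle `Δ` joins the two tetrahedra that contain it. -/
def DualJoins (G : TetGluing K) (Δ : G.Simplex) (t t' : K) : Prop :=
  ∃ i p, G.adj t i = some (t', p) ∧ Δ = G.image (localTriangle t i)

/-- A spanning tree of tetrahedra, given by the set of its internal triangles: a set of interior
triangles that is a spanning tree of the dual graph. -/
structure IsSpanningTreeOfTetrahedra (G : TetGluing K) (S : Set G.Simplex) : Prop where
  interior : ∀ Δ ∈ S, ∃ t t', G.DualJoins Δ t t'
  tree : IsSpanningTreeOf G.DualJoins S

/-- The 1-skeleton: the edge `e` joins its endpoints `u` and `v`. -/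
def EdgeJoins (G : TetGluing K) (e : G.Simplex) (u v : {v : G.Simplex // v.dim = 0}) : Prop :=
  ∃ t a b, a ≠ b ∧ e = G.image (localEdge t a b) ∧
    u.1 = G.image (localVertex t a) ∧ v.1 = G.image (localVertex t b)

/-- A spanning tree of edges: a set of edges that is a spanning tree of the 1-skeleton. -/
structure IsSpanningTreeOfEdges (G : TetGluing K) (E : Set G.Simplex) : Prop where
  dim_eq_one : ∀ e ∈ E, e.dim = 1
  tree : IsSpanningTreeOf G.EdgeJoins E

open Classical in
/-- The complex made of all the tetrahedra of `G`, glued only along the triangles in `S`. If `S` is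
a spanning tree of the dual graph, this is the corresponding tree of tetrahedra. -/
noncomputable def restrict (G : TetGluing K) (S : Set G.Simplex) : TetGluing K where
  adj t i := if G.image (localTriangle t i) ∈ S then G.adj t i else none
  adj_symm := by
    intro t i t' p h
    split_ifs at h with hS
    rw [← G.image_localTriangle_eq h, if_pos hS]
    exact G.adj_symm _ _ _ _ h
  adj_irrefl := by
    intro t i p h
    split_ifs at h with hS
    exact G.adj_irrefl _ _ _ h
  adj_sign := by
    intro t i t' p h
    split_ifs at h with hS
    exact G.adj_sign _ _ _ _ h

/-- One step of a local construction: `e` is an edge of `G` shared by two distinct boundary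
triangles (triangle `i` of `t` and triangle `p i` of `t'`), and `G'` is obtained from `G` by gluing
these two triangles, through the gluing map that is the identity on `e` (the two remaining pairs of
edges that get identified being the pairs that share an endpoint of `e`). -/
def IsGluingStep (G : TetGluing K) (e : G.Simplex) (G' : TetGluing K) : Prop :=
  ∃ (t t' : K) (i a b : Fin 4) (p : Equiv.Perm (Fin 4)),
    a ≠ b ∧ a ≠ i ∧ b ≠ i ∧ (t, i) ≠ (t', p i) ∧
    G.adj t i = none ∧ G.adj t' (p i) = none ∧
    e = G.image (localEdge t a b) ∧
    (∃ q, G.Carries {a, b} t t' q ∧ q a = p a ∧ q b = p b) ∧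
    G'.adj t i = some (t', p) ∧ G'.adj t' (p i) = some (t, p⁻¹) ∧
    ∀ u j, (u, j) ≠ (t, i) → (u, j) ≠ (t', p i) → G'.adj u j = G.adj u j

/-- A local construction of `T` starting from the complex `T₀`: a sequence
`T₀ = stage 0, …, stage n = T`, where at every step two boundary triangles sharing an edge are
glued together, and where a shared edge along which this is done is chosen. -/
structure LocalConstruction (T₀ T : TetGluing K) where
  length : ℕ
  stage : Fin (length + 1) → TetGluing K
  edge : (s : Fin length) → (stage s.castSucc).Simplex
  start : stage 0 = T₀
  finish : stage (Fin.last length) = T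
  step : ∀ s, (stage s.castSucc).IsGluingStep (edge s) (stage s.succ)

/-- `σ` is a face of `τ`, possibly equal to `τ`. -/
def IsFace (G : TetGluing K) (σ τ : G.Simplex) : Prop :=
  ∃ x y : LocalSimplex K, x.tet = y.tet ∧ x.verts ⊆ y.verts ∧ G.image x = σ ∧ G.image y = τ

/-- `σ` occurs exactly once among the faces of `τ` (before identification). -/
def IsFaceOnce (G : TetGluing K) (σ τ : G.Simplex) : Prop :=
  ∃ y : LocalSimplex K, G.image y = τ ∧
    ∃! x : LocalSimplex K, x.tet = y.tet ∧ x.verts ⊆ y.verts ∧ G.image x = σ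

/-- `C'` is obtained from the set of simplices `C` by the elementary collapse that removes the
simplex `τ` and its free face `σ` of codimension one. -/
structure IsElementaryCollapse (G : TetGluing K) (C : Set G.Simplex) (σ τ : G.Simplex)
    (C' : Set G.Simplex) : Prop where
  mem_face : σ ∈ C
  mem_simplex : τ ∈ C
  dim_eq : τ.dim = σ.dim + 1
  once : G.IsFaceOnce σ τ
  free : ∀ ρ ∈ C, G.IsFace σ ρ → ρ = σ ∨ ρ = τ
  eq_diff : C' = C \ {σ, τ}

/-- The 2-complex obtained from `G` by removing all the tetrahedra and the triangles in `S`. -/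
def twoComplex (G : TetGluing K) (S : Set G.Simplex) : Set G.Simplex :=
  {c | c.dim ≤ 2 ∧ c ∉ S}

/-- A set `E` of edges, seen as a 1-complex that contains all the vertices. -/
def edgeComplex (G : TetGluing K) (E : Set G.Simplex) : Set G.Simplex :=
  {c | c.dim = 0} ∪ E

/-- A collapsing sequence of the 2-complex `G.twoComplex S` onto a spanning tree of edges (which is
part of the data): the simplex `big s` and its free face `small s` are removed at step `s`. -/
structure CollapsingSequence (G : TetGluing K) (S : Set G.Simplex) where
  tree : Set G.Simplex
  isTree : G.IsSpanningTreeOfEdges tree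
  length : ℕ
  stage : Fin (length + 1) → Set G.Simplex
  small : Fin length → G.Simplex
  big : Fin length → G.Simplex
  start : stage 0 = G.twoComplex S
  finish : stage (Fin.last length) = G.edgeComplex tree
  step : ∀ s, G.IsElementaryCollapse (stage s.castSucc) (small s) (big s) (stage s.succ)

/-- The step-by-step correspondence between a local construction of `T` and a collapsing sequence:
they have the same number of steps, and at every step `s` the collapse removes the triangle of `T`
that results from the two triangles glued at step `s`, and the edge of `T` that is the image of the
chosen edge. -/
def Corresponds {T : TetGluing K} {S : Set T.Simplex}
    (L : LocalConstruction (T.restrict S) T) (C : T.CollapsingSequence S) : Prop :=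
  ∃ h : C.length = L.length, ∀ s : Fin L.length,
    (∀ t i, (L.stage s.castSucc).adj t i = none → (L.stage s.succ).adj t i ≠ none →
      T.image (localTriangle t i) = C.big (s.cast h.symm)) ∧
    (∀ x, (L.stage s.castSucc).image x = L.edge s → T.image x = C.small (s.cast h.symm))

end TetGluing

/-!
A local construction and a collapsing sequence both amount to the same data: an enumeration
`τ₁, …, τₙ` of the triangles of `T` that are not in `S` and, for each of them, an edge `σₛ` that is
a free face of `τₛ` in the 2-complex left when `τ₁, …, τₛ₋₁` are removed. This is
`TetGluing.FreeSequence`, and the bijection goes through it.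

*Gluing steps are free faces.* Every stage of a local construction is `T.restrict R`, where `R` is
the set of the triangles glued so far. The tetrahedra around an edge `σ` of `T` form a cycle, which
is encoded as a cycle of the permutation `turn` of the even flags; since the gluing maps reverse
orientations, no edge is identified with itself reversed (`not_sameCycle_reverse`). Each triangle
outside `R` leaves a gap in the cycle wherever `σ` is one of its sides. The two copies of a triangle
`τ ∉ R` share an edge above `σ`, compatibly with the gluing map, if and only if the gap they bound
is the only one (`onlyGap_iff_carries`), that is, if and only if `σ` is a free face of `τ`
(`onlyGap_iff_isFreeFace`). The copies of `σ` then form a single edge of `T.restrict R`, so that `σ`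
determines the chosen edge (`OnlyGap.image_eq_iff`).

*The remaining edges form a spanning tree.* They connect all the vertices, since the ends of a
removed edge stay joined by the other two sides of its triangle. It remains to see that they are
fewer than the vertices. If `T` has `N` tetrahedra, it has at least `2 * N` triangles, at most
`N - 1` of them in `S`, so that at least `N + 1` edges are removed. On the other hand there are at
most as many edges as vertices and tetrahedra together (`card_edges_le`), because the links of the
vertices are closed surfaces, whose genus is non-negative. The last fact is an inequality between
numbers of cycles of permutations (`cycleCount_add_le`), proved with spaces of invariant functions.

Conversely, a collapsing sequence onto a spanning tree of edges keeps all the vertices, and hence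
removes an edge and a triangle at every step.
-/

/-! ### The genus inequality for a pair of permutations -/

open Equiv.Perm in
/-- The number of cycles of a permutation, fixed points included. -/
noncomputable def cycleCount {X : Type*} (σ : Equiv.Perm X) : ℕ :=
  Nat.card (Quotient (SameCycle.setoid σ))

/-- The space of the rational functions that are constant on the classes of `r`. -/
def classFunctions {X : Type*} (r : Setoid X) : Submodule ℚ (X → ℚ) :=
  LinearMap.range (LinearMap.funLeft ℚ ℚ (Quotient.mk r))

theorem mem_classFunctions {X : Type*} {r : Setoid X} {f : X → ℚ} :
    f ∈ classFunctions r ↔ r ≤ Setoid.ker f := by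
  constructor
  · rintro ⟨g, rfl⟩ x y hxy
    exact congrArg g (Quotient.sound hxy)
  · intro h
    exact ⟨Quotient.lift f fun x y hxy => h hxy, rfl⟩

theorem finrank_classFunctions {X : Type*} [Finite X] (r : Setoid X) :
    Module.finrank ℚ (classFunctions r) = Nat.card (Quotient r) := by
  have := Fintype.ofFinite (Quotient r)
  rw [classFunctions, LinearMap.finrank_range_of_inj
    (LinearMap.funLeft_injective_of_surjective _ _ _ Quotient.mk_surjective),
    Module.finrank_fintype_fun_eq_card, Nat.card_eq_fintype_card]

theorem sameCycle_setoid_le_ker {X Y : Type*} {σ : Equiv.Perm X} {f : X → Y}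
    (h : ∀ x, f (σ x) = f x) : Equiv.Perm.SameCycle.setoid σ ≤ Setoid.ker f := by
  rintro x y ⟨n, rfl⟩
  change f x = f ((σ ^ n) x)
  induction n using Int.induction_on with
  | zero => simp
  | succ n ih => rw [ih, add_comm, zpow_add, zpow_one, Equiv.Perm.mul_apply, h]
  | pred n ih =>
    rw [ih, ← h ((σ ^ (-(n : ℤ) - 1)) x), ← Equiv.Perm.mul_apply, ← zpow_one_add]
    congr 3
    ring

theorem mem_classFunctions_sameCycle {X : Type*} {σ : Equiv.Perm X} {f : X → ℚ} :
    f ∈ classFunctions (Equiv.Perm.SameCycle.setoid σ) ↔ ∀ x, f (σ x) = f x := by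
  rw [mem_classFunctions]
  refine ⟨fun h x => ?_, sameCycle_setoid_le_ker⟩
  exact (h (show σ.SameCycle x (σ x) from ⟨1, by simp⟩)).symm

theorem classFunctions_sup {X : Type*} (r s : Setoid X) :
    classFunctions (r ⊔ s) = classFunctions r ⊓ classFunctions s := by
  ext f
  simp [mem_classFunctions]

open Equiv.Perm in
/-- The genus of the map with rotation `σ` and edge involution `α` is non-negative. For a function
`d` invariant under `σ * α`, the difference `d ∘ σ - d = d ∘ α - d` is orthogonal to the functions
invariant under `σ` and to those invariant under `α`; it vanishes when `d` is invariant under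
both. -/
theorem cycleCount_add_le {X : Type*} [Finite X] (σ α : Equiv.Perm X) (hα : ∀ x, α (α x) = x) :
    cycleCount σ + cycleCount α + cycleCount (σ * α) ≤
      Nat.card X + 2 * Nat.card (Quotient (SameCycle.setoid σ ⊔ SameCycle.setoid α)) := by
  have := Fintype.ofFinite X
  unfold cycleCount
  simp only [← finrank_classFunctions]
  set A := classFunctions (SameCycle.setoid σ) with hA
  set B := classFunctions (SameCycle.setoid α) with hB
  set D := classFunctions (SameCycle.setoid (σ * α)) with hD
  rw [classFunctions_sup, ← hA, ← hB]
  have hDα : ∀ d ∈ D, ∀ x, d (σ x) = d (α x) := by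
    intro d hd x
    have := mem_classFunctions_sameCycle.1 hd (α x)
    rwa [Equiv.Perm.mul_apply, hα] at this
  let Ψ : (X → ℚ) →ₗ[ℚ] Module.Dual ℚ (X → ℚ) :=
    LinearMap.mk₂ ℚ (fun d w => ∑ x, (d (σ x) - d x) * w x)
      (fun a b c => by simp only [Pi.add_apply, ← Finset.sum_add_distrib]; congr! 1; ring)
      (fun a b c => by
        simp only [Pi.smul_apply, smul_eq_mul, Finset.mul_sum]; congr! 1; ring)
      (fun a b c => by simp only [Pi.add_apply, ← Finset.sum_add_distrib]; congr! 1; ring)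
      (fun a b c => by
        simp only [Pi.smul_apply, smul_eq_mul, Finset.mul_sum]; congr! 1; ring)
  have hΨ : ∀ d w, Ψ d w = ∑ x, (d (σ x) - d x) * w x := fun _ _ => rfl
  have hrange : LinearMap.range (Ψ.domRestrict D) ≤ (A ⊔ B).dualAnnihilator := by
    rintro _ ⟨⟨d, hd⟩, rfl⟩
    rw [Submodule.dualAnnihilator_sup_eq]
    constructor
    · refine (Submodule.mem_dualAnnihilator _).2 fun w hw => ?_
      have hw' := mem_classFunctions_sameCycle.1 hw
      rw [LinearMap.domRestrict_apply, hΨ]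
      simp only [sub_mul, Finset.sum_sub_distrib]
      rw [sub_eq_zero, ← Equiv.sum_comp σ fun x => d x * w x]
      simp only [hw']
    · refine (Submodule.mem_dualAnnihilator _).2 fun w hw => ?_
      have hw' := mem_classFunctions_sameCycle.1 hw
      rw [LinearMap.domRestrict_apply, hΨ]
      simp only [sub_mul, Finset.sum_sub_distrib]
      rw [sub_eq_zero, ← Equiv.sum_comp α fun x => d x * w x]
      simp only [hw', hDα d hd]
  have hker : (LinearMap.ker (Ψ.domRestrict D)).map D.subtype ≤ A ⊓ B := by
    rintro _ ⟨⟨d, hd⟩, hk, rfl⟩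
    have hzero : ∀ x, d (σ x) - d x = 0 := by
      intro x
      classical
      have := LinearMap.congr_fun (LinearMap.mem_ker.1 hk) (Pi.single x 1)
      rw [LinearMap.domRestrict_apply, hΨ] at this
      simpa [Pi.single_apply] using this
    refine ⟨mem_classFunctions_sameCycle.2 fun x => sub_eq_zero.1 (hzero x),
      mem_classFunctions_sameCycle.2 fun x => ?_⟩
    change d (α x) = d x
    rw [← hDα d hd, sub_eq_zero.1 (hzero x)]
  have h1 := LinearMap.finrank_range_add_finrank_ker (Ψ.domRestrict D)
  have h2 := Submodule.finrank_mono hrange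
  have h3 := Submodule.finrank_mono hker
  rw [Submodule.finrank_map_subtype_eq] at h3
  have h4 := Subspace.finrank_add_finrank_dualAnnihilator_eq (A ⊔ B)
  have h5 := Submodule.finrank_sup_add_finrank_inf_eq A B
  rw [Module.finrank_fintype_fun_eq_card, ← Nat.card_eq_fintype_card] at h4
  omega

/-- Every cycle of an involution has at most two elements. -/
theorem card_le_two_mul_cycleCount {X : Type*} [Finite X] (α : Equiv.Perm X)
    (hα : ∀ x, α (α x) = x) : Nat.card X ≤ 2 * cycleCount α := by
  classical
  have hf : Function.Surjective (fun p : Quotient (Equiv.Perm.SameCycle.setoid α) × Bool =>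
      bif p.2 then α p.1.out else p.1.out) := by
    intro x
    obtain ⟨n, hn⟩ : α.SameCycle (Quotient.mk (Equiv.Perm.SameCycle.setoid α) x).out x :=
      Quotient.mk_out (s := Equiv.Perm.SameCycle.setoid α) x
    have hsq : α ^ (2 : ℤ) = 1 := by
      ext y
      rw [zpow_two, Equiv.Perm.mul_apply]
      exact hα y
    obtain ⟨m, rfl | rfl⟩ := Int.even_or_odd' n
    · refine ⟨(Quotient.mk _ x, false), ?_⟩
      simpa [zpow_mul, hsq] using hn
    · refine ⟨(Quotient.mk _ x, true), ?_⟩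
      simpa [zpow_add, zpow_mul, hsq] using hn
  have := Nat.card_le_card_of_surjective _ hf
  rwa [Nat.card_prod, Nat.card_eq_fintype_card (α := Bool), Fintype.card_bool, mul_comm] at this

/-! ### Simplices of a glued complex -/

namespace TetGluing

variable {K : Type*}

theorem Carries.mono {G : TetGluing K} {A B : Finset (Fin 4)} {t t' : K} {p : Equiv.Perm (Fin 4)}
    (h : G.Carries B t t' p) (hAB : A ⊆ B) : G.Carries A t t' p := by
  induction h with
  | refl => exact .refl
  | cross _ ha hadj ih => exact ih.cross (fun a haA => ha a (hAB haA)) hadj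

/-- Gluings are compared through their gluing maps: `G.Le T` says that `T` is obtained from `G` by
gluing more triangles. -/
def Le (G T : TetGluing K) : Prop := ∀ t i y, G.adj t i = some y → T.adj t i = some y

theorem Carries.of_le {G T : TetGluing K} (hGT : G.Le T) {A : Finset (Fin 4)} {t t' : K}
    {p : Equiv.Perm (Fin 4)} (h : G.Carries A t t' p) : T.Carries A t t' p := by
  induction h with
  | refl => exact .refl
  | cross _ ha hadj ih => exact ih.cross ha (hGT _ _ _ hadj)

theorem restrict_adj_eq_some {T : TetGluing K} {R : Set T.Simplex} {t : K} {i : Fin 4}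
    {y : K × Equiv.Perm (Fin 4)} :
    (T.restrict R).adj t i = some y ↔ T.image (localTriangle t i) ∈ R ∧ T.adj t i = some y := by
  simp only [restrict]
  split_ifs with h <;> simp [h]

theorem restrict_adj_eq_none {T : TetGluing K} (hT : T.IsClosed) {R : Set T.Simplex} {t : K}
    {i : Fin 4} : (T.restrict R).adj t i = none ↔ T.image (localTriangle t i) ∉ R := by
  simp only [restrict]
  split_ifs with h <;> simp [h, hT t i]

theorem restrict_le (T : TetGluing K) (R : Set T.Simplex) : (T.restrict R).Le T :=
  fun _ _ _ h => (restrict_adj_eq_some.1 h).2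

theorem image_eq_iff {G : TetGluing K} {x y : LocalSimplex K} :
    G.image x = G.image y ↔
      ∃ p, G.Carries x.verts x.tet y.tet p ∧ x.verts.map p.toEmbedding = y.verts :=
  Quotient.eq (r := G.simplexSetoid)

theorem exists_image_eq {G : TetGluing K} (c : G.Simplex) : ∃ x, G.image x = c :=
  Quotient.exists_rep c

theorem image_eq_of_le {G T : TetGluing K} (hGT : G.Le T) {x y : LocalSimplex K}
    (h : G.image x = G.image y) : T.image x = T.image y := by
  obtain ⟨p, hp, hxy⟩ := image_eq_iff.1 h
  exact image_eq_iff.2 ⟨p, hp.of_le hGT, hxy⟩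

theorem dim_image (G : TetGluing K) (x : LocalSimplex K) : (G.image x).dim = x.verts.card - 1 :=
  rfl

theorem dim_localTriangle (G : TetGluing K) (t : K) (i : Fin 4) :
    (G.image (localTriangle t i)).dim = 2 := by
  simp [dim_image, localTriangle, Finset.card_compl]

theorem dim_localEdge (G : TetGluing K) (t : K) {a b : Fin 4} (hab : a ≠ b) :
    (G.image (localEdge t a b)).dim = 1 := by
  simp [dim_image, localEdge, Finset.card_pair hab]

theorem dim_localVertex (G : TetGluing K) (t : K) (a : Fin 4) :
    (G.image (localVertex t a)).dim = 0 := by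
  simp [dim_image, localVertex]

theorem localEdge_comm (t : K) (a b : Fin 4) : localEdge t a b = localEdge t b a := by
  simp [localEdge, Finset.pair_comm]

theorem eq_localEdge {G : TetGluing K} {x : LocalSimplex K} (h : (G.image x).dim = 1) :
    ∃ a b, a ≠ b ∧ x = localEdge x.tet a b := by
  rw [dim_image] at h
  obtain ⟨a, b, hab, hx⟩ := Finset.card_eq_two.1 (show x.verts.card = 2 by omega)
  exact ⟨a, b, hab, LocalSimplex.ext rfl hx⟩

theorem eq_localTriangle {G : TetGluing K} {x : LocalSimplex K} (h : (G.image x).dim = 2) :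
    ∃ i, x = localTriangle x.tet i := by
  rw [dim_image] at h
  have h1 : x.vertsᶜ.card = 1 := by
    rw [Finset.card_compl, Fintype.card_fin]
    omega
  obtain ⟨i, hi⟩ := Finset.card_eq_one.1 h1
  exact ⟨i, LocalSimplex.ext rfl (by simp [localTriangle, ← hi])⟩

theorem eq_localVertex {G : TetGluing K} {x : LocalSimplex K} (h : (G.image x).dim = 0) :
    ∃ a, x = localVertex x.tet a := by
  rw [dim_image] at h
  have := x.nonempty.card_pos
  obtain ⟨a, hx⟩ := Finset.card_eq_one.1 (show x.verts.card = 1 by omega)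
  exact ⟨a, LocalSimplex.ext rfl hx⟩

/-- A triangle of the glued complex is the image of exactly the two triangles glued together. -/
theorem image_localTriangle_eq_iff {G : TetGluing K} {t u : K} {i j : Fin 4} :
    G.image (localTriangle t i) = G.image (localTriangle u j) ↔
      (u = t ∧ j = i) ∨ ∃ p, G.adj t i = some (u, p) ∧ p i = j := by
  constructor
  · intro h
    obtain ⟨q, hq, hmap⟩ := image_eq_iff.1 h
    have hj : q i = j := by
      by_contra hne
      have h1 : q i ∈ (localTriangle u j).verts := by simpa [localTriangle] using hne
      rw [← hmap] at h1
      simp [localTriangle] at h1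
    have key : ∀ {v : K} {q : Equiv.Perm (Fin 4)}, G.Carries {i}ᶜ t v q →
        (v = t ∧ q = 1) ∨ G.adj t i = some (v, q) := by
      intro v q hc
      induction hc with
      | refl => exact .inl ⟨rfl, rfl⟩
      | @cross v w q r k _ hk hadj ih =>
        have hki : k = q i := by
          by_contra hne
          refine hk (q.symm k) ?_ (by simp)
          simpa [Equiv.symm_apply_eq] using hne
        subst hki
        rcases ih with ⟨rfl, rfl⟩ | ih
        · right
          simpa using hadj
        · have h1 := G.adj_symm _ _ _ _ ih
          rw [hadj, Option.some.injEq, Prod.mk.injEq] at h1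
          left
          exact ⟨h1.1, by rw [h1.2]; simp⟩
    rcases key hq with ⟨h1, h2⟩ | h1
    · exact .inl ⟨h1, by simp [← hj, h2]⟩
    · exact .inr ⟨q, h1, hj⟩
  · rintro (⟨rfl, rfl⟩ | ⟨p, hp, rfl⟩)
    · rfl
    · exact G.image_localTriangle_eq hp

theorem IsFace.eq_of_dim_le {G : TetGluing K} {σ τ : G.Simplex} (h : G.IsFace σ τ)
    (hd : τ.dim ≤ σ.dim) : σ = τ := by
  obtain ⟨x, y, ht, hxy, rfl, rfl⟩ := h
  rw [dim_image, dim_image] at hd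
  have h1 := x.nonempty.card_pos
  have h2 := y.nonempty.card_pos
  rw [LocalSimplex.ext ht (Finset.eq_of_subset_of_card_le hxy (by omega))]

/-- The uniqueness of the occurrence of a face does not depend on the tetrahedron in which it is
tested. -/
theorem IsFaceOnce.eq {G : TetGluing K} {σ : G.Simplex} {y x x' : LocalSimplex K}
    (h : G.IsFaceOnce σ (G.image y)) (ht : x.tet = y.tet) (hx : x.verts ⊆ y.verts)
    (hσ : G.image x = σ) (ht' : x'.tet = y.tet) (hx' : x'.verts ⊆ y.verts)
    (hσ' : G.image x' = σ) : x = x' := by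
  obtain ⟨z, hz, w, -, hw⟩ := h
  obtain ⟨p, hp, hmap⟩ := image_eq_iff.1 hz.symm
  have key : ∀ x : LocalSimplex K, x.tet = y.tet → x.verts ⊆ y.verts → G.image x = σ →
      x.verts.map p.toEmbedding = w.verts := by
    intro x ht hx hσ
    have := hw ⟨z.tet, x.verts.map p.toEmbedding, x.nonempty.map⟩
      ⟨rfl, hmap ▸ Finset.map_subset_map.2 hx, by
        rw [← hσ]
        exact (image_eq_iff.2 ⟨p, ht ▸ hp.mono hx, rfl⟩).symm⟩
    exact congrArg LocalSimplex.verts this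
  refine LocalSimplex.ext (ht.trans ht'.symm) (Finset.map_injective p.toEmbedding ?_)
  rw [key x ht hx hσ, key x' ht' hx' hσ']

theorem IsFaceOnce.isFace {G : TetGluing K} {σ τ : G.Simplex} (h : G.IsFaceOnce σ τ) :
    G.IsFace σ τ := by
  obtain ⟨y, hy, x, ⟨ht, hx, hσ⟩, -⟩ := h
  exact ⟨x, y, ht, hx, hσ, hy⟩

/-! ### Flags and the rotation of the tetrahedra around an edge -/

/-- An even flag: a tetrahedron together with an even ordering of its four vertices. The flag
`(t, f)` stands for the edge `f 0`–`f 1` of `t`, oriented, with the two triangles of `t` around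
it, opposite to `f 2` and to `f 3`. -/
abbrev Flag (K : Type*) := K × alternatingGroup (Fin 4)

theorem exists_even_perm_of_ne : ∀ {a b : Fin 4}, a ≠ b →
    ∃ f : alternatingGroup (Fin 4), f.1 0 = a ∧ f.1 1 = b := by
  have : ∀ a b : Fin 4, a ≠ b →
    ∃ f : Equiv.Perm (Fin 4), Equiv.Perm.sign f = 1 ∧ f 0 = a ∧ f 1 = b := by decide
  intro a b hab
  obtain ⟨f, hf, h⟩ := this a b hab
  exact ⟨⟨f, Equiv.Perm.mem_alternatingGroup.2 hf⟩, h⟩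

theorem even_perm_eq {f g : alternatingGroup (Fin 4)} (h0 : f.1 0 = g.1 0) (h1 : f.1 1 = g.1 1) :
    f = g := by
  have key : ∀ h : Equiv.Perm (Fin 4), Equiv.Perm.sign h = 1 → h 0 = 0 → h 1 = 1 → h = 1 := by
    decide
  have h := key (g⁻¹ * f).1 (g⁻¹ * f).2 (by simp [h0]) (by simp [h1])
  exact (inv_mul_eq_one.1 (Subtype.ext h : g⁻¹ * f = 1)).symm

theorem perm_eq_two_or_three {f : Equiv.Perm (Fin 4)} {i : Fin 4} (h0 : f 0 ≠ i) (h1 : f 1 ≠ i) :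
    i = f 2 ∨ i = f 3 := by
  obtain ⟨j, rfl⟩ := f.surjective i
  fin_cases j <;> simp_all

/-- Right multiplication of the orderings of the vertices, as a permutation of the flags. -/
def reorder (g : alternatingGroup (Fin 4)) : Equiv.Perm (Flag K) :=
  Equiv.prodCongr (Equiv.refl K) (Equiv.mulRight g)

/-- The same edge with the opposite orientation, and the two triangles around it exchanged. -/
def reverse (x : Flag K) : Flag K :=
  (x.1, x.2 * ⟨Equiv.swap 0 1 * Equiv.swap 2 3,
    Equiv.Perm.mem_alternatingGroup.2 (by decide)⟩)

section reverse

variable (x : Flag K)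

theorem reverse_zero : (reverse x).2.1 0 = x.2.1 1 := by
  change x.2.1 ((Equiv.swap 0 1 * Equiv.swap 2 3 : Equiv.Perm (Fin 4)) 0) = _
  congr 1

theorem reverse_one : (reverse x).2.1 1 = x.2.1 0 := by
  change x.2.1 ((Equiv.swap 0 1 * Equiv.swap 2 3 : Equiv.Perm (Fin 4)) 1) = _
  congr 1

theorem reverse_two : (reverse x).2.1 2 = x.2.1 3 := by
  change x.2.1 ((Equiv.swap 0 1 * Equiv.swap 2 3 : Equiv.Perm (Fin 4)) 2) = _
  congr 1

theorem reverse_three : (reverse x).2.1 3 = x.2.1 2 := by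
  change x.2.1 ((Equiv.swap 0 1 * Equiv.swap 2 3 : Equiv.Perm (Fin 4)) 3) = _
  congr 1

theorem reverse_reverse : reverse (reverse x) = x :=
  Prod.ext rfl
    (even_perm_eq (by rw [reverse_zero, reverse_one]) (by rw [reverse_one, reverse_zero]))

end reverse

theorem Flag.ext_edge {x y : Flag K} (h : x.1 = y.1) (h0 : x.2.1 0 = y.2.1 0)
    (h1 : x.2.1 1 = y.2.1 1) : x = y :=
  Prod.ext h (even_perm_eq h0 h1)

/-- The edge of a flag. -/
def flagEdge (x : Flag K) : LocalSimplex K := localEdge x.1 (x.2.1 0) (x.2.1 1)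

theorem flagEdge_reverse (x : Flag K) : flagEdge (reverse x) = flagEdge x := by
  rw [flagEdge, reverse_zero, reverse_one, localEdge_comm]
  rfl

theorem eq_or_eq_reverse_of_flagEdge_eq {x y : Flag K} (h : flagEdge x = flagEdge y) :
    x = y ∨ x = reverse y := by
  have ht : x.1 = y.1 := congrArg LocalSimplex.tet h
  have hv : ({x.2.1 0, x.2.1 1} : Finset (Fin 4)) = {y.2.1 0, y.2.1 1} :=
    congrArg LocalSimplex.verts h
  have hx : x.2.1 0 ≠ x.2.1 1 := fun h => by simpa using x.2.1.injective h
  have h0 : x.2.1 0 ∈ ({y.2.1 0, y.2.1 1} : Finset (Fin 4)) := by simp [← hv]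
  have h1 : x.2.1 1 ∈ ({y.2.1 0, y.2.1 1} : Finset (Fin 4)) := by simp [← hv]
  simp only [Finset.mem_insert, Finset.mem_singleton] at h0 h1
  rcases h0 with h0 | h0 <;> rcases h1 with h1 | h1
  · exact absurd (h0.trans h1.symm) hx
  · exact .inl (Flag.ext_edge ht h0 h1)
  · exact .inr (Flag.ext_edge ht (by rw [h0, reverse_zero]) (by rw [h1, reverse_one]))
  · exact absurd (h0.trans h1.symm) hx

theorem exists_flagEdge_eq (t : K) {a b : Fin 4} (hab : a ≠ b) :
    ∃ x : Flag K, x.1 = t ∧ x.2.1 0 = a ∧ x.2.1 1 = b := by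
  obtain ⟨f, h0, h1⟩ := exists_even_perm_of_ne hab
  exact ⟨(t, f), rfl, h0, h1⟩

variable {T : TetGluing K}

/-- The triangle of the complex that is opposite to the last vertex of a flag. -/
def flagTriangle (T : TetGluing K) (x : Flag K) : T.Simplex :=
  T.image (localTriangle x.1 (x.2.1 3))

/-- The tetrahedron across a triangle in a closed triangulation, with the gluing map. -/
def across (hT : T.IsClosed) (t : K) (i : Fin 4) : K × Equiv.Perm (Fin 4) :=
  (T.adj t i).get (Option.isSome_iff_ne_none.2 (hT t i))

theorem adj_eq_across (hT : T.IsClosed) (t : K) (i : Fin 4) :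
    T.adj t i = some ((across hT t i).1, (across hT t i).2) := by
  simp [across]

/-- Turning around an edge of the closed triangulation `T`: the triangle opposite to the last vertex
is crossed. The other triangle of the new tetrahedron around the edge is then the one opposite to
the last vertex of the new flag. -/
def turnFlag (hT : T.IsClosed) (x : Flag K) : Flag K :=
  ((across hT x.1 (x.2.1 3)).1, ⟨(across hT x.1 (x.2.1 3)).2 * x.2.1 * Equiv.swap 2 3, by
    have h1 := T.adj_sign _ _ _ _ (adj_eq_across hT x.1 (x.2.1 3))
    have h2 : Equiv.Perm.sign x.2.1 = 1 := x.2.2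
    rw [Equiv.Perm.mem_alternatingGroup]
    simp [h1, h2]⟩)

section turnFlag

variable (hT : T.IsClosed) (x : Flag K)

theorem exists_adj_turnFlag : ∃ p, T.adj x.1 (x.2.1 3) = some ((turnFlag hT x).1, p) ∧
    (turnFlag hT x).2.1 0 = p (x.2.1 0) ∧ (turnFlag hT x).2.1 1 = p (x.2.1 1) ∧
    (turnFlag hT x).2.1 2 = p (x.2.1 3) ∧ (turnFlag hT x).2.1 3 = p (x.2.1 2) := by
  refine ⟨_, adj_eq_across hT _ _, ?_, ?_, ?_, ?_⟩ <;> simp only [turnFlag, Equiv.Perm.mul_apply]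
  · rw [Equiv.swap_apply_of_ne_of_ne (by decide) (by decide)]
  · rw [Equiv.swap_apply_of_ne_of_ne (by decide) (by decide)]
  · rw [Equiv.swap_apply_left]
  · rw [Equiv.swap_apply_right]

theorem turnFlag_reverse_turnFlag :
    turnFlag hT (reverse (turnFlag hT x)) = reverse x := by
  obtain ⟨p, hp, h0, h1, h2, -⟩ := exists_adj_turnFlag hT x
  obtain ⟨q, hq, h0', h1', -, -⟩ := exists_adj_turnFlag hT (reverse (turnFlag hT x))
  rw [reverse_three, h2] at hq
  have h := T.adj_symm _ _ _ _ hp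
  change T.adj (turnFlag hT x).1 _ = _ at hq
  rw [h, Option.some.injEq, Prod.mk.injEq] at hq
  refine Flag.ext_edge hq.1.symm ?_ ?_
  · simp [h0', ← hq.2, reverse_zero, h1]
  · simp [h1', ← hq.2, reverse_one, h0]

end turnFlag

/-- `turnFlag` as a permutation of the flags. -/
def turn (hT : T.IsClosed) : Equiv.Perm (Flag K) where
  toFun := turnFlag hT
  invFun x := reverse (turnFlag hT (reverse x))
  left_inv x := by
    change reverse (turnFlag hT (reverse (turnFlag hT x))) = x
    rw [turnFlag_reverse_turnFlag, reverse_reverse]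
  right_inv x := by rw [turnFlag_reverse_turnFlag, reverse_reverse]

section turn

variable (hT : T.IsClosed)

theorem exists_adj_turn (x : Flag K) : ∃ p, T.adj x.1 (x.2.1 3) = some ((turn hT x).1, p) ∧
    (turn hT x).2.1 0 = p (x.2.1 0) ∧ (turn hT x).2.1 1 = p (x.2.1 1) ∧
    (turn hT x).2.1 2 = p (x.2.1 3) ∧ (turn hT x).2.1 3 = p (x.2.1 2) :=
  exists_adj_turnFlag hT x

theorem image_localTriangle_turn (x : Flag K) :
    T.image (localTriangle (turn hT x).1 ((turn hT x).2.1 2)) = flagTriangle T x := by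
  obtain ⟨p, hp, -, -, h2, -⟩ := exists_adj_turn hT x
  rw [h2]
  exact (T.image_localTriangle_eq hp).symm

theorem turn_reverse_turn (x : Flag K) : turn hT (reverse (turn hT x)) = reverse x :=
  turnFlag_reverse_turnFlag hT x

/-- Reversing the edges conjugates `turn` to its inverse. -/
theorem turn_zpow_reverse (n : ℤ) (x : Flag K) :
    ((turn hT) ^ n) (reverse ((turn hT ^ n) x)) = reverse x := by
  induction n using Int.induction_on with
  | zero => rfl
  | succ n ih =>
    have h : (turn hT ^ ((n : ℤ) + 1)) x = turn hT ((turn hT ^ (n : ℤ)) x) := by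
      rw [add_comm, zpow_one_add, Equiv.Perm.mul_apply]
    rw [h, zpow_add_one, Equiv.Perm.mul_apply, turn_reverse_turn, ih]
  | pred n ih =>
    have h : (turn hT ^ (-(n : ℤ))) x = turn hT ((turn hT ^ (-(n : ℤ) - 1)) x) := by
      rw [← Equiv.Perm.mul_apply, ← zpow_one_add]
      congr 2
      ring
    rw [← turn_reverse_turn hT ((turn hT ^ (-(n : ℤ) - 1)) x), ← Equiv.Perm.mul_apply,
      ← zpow_add_one, sub_add_cancel, ← h, ih]

/-- An edge is never identified with itself in the opposite direction: turning around it, one would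
otherwise meet a flag fixed by `reverse`, or a triangle glued to itself. -/
theorem not_sameCycle_reverse (x : Flag K) : ¬ (turn hT).SameCycle x (reverse x) := by
  rintro ⟨n, hn⟩
  obtain ⟨m, hm⟩ := Int.even_or_odd' n
  -- Halfway from `x` to `reverse x`, the flag `reverse y` is equal to `y` or to `turn y`.
  set y := (turn hT ^ m) x with hy
  have h1 := turn_zpow_reverse hT m x
  rw [← hn, ← hy] at h1
  rcases hm with rfl | rfl
  · rw [two_mul, zpow_add, Equiv.Perm.mul_apply, ← hy, EmbeddingLike.apply_eq_iff_eq] at h1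
    have h2 := reverse_zero y
    rw [h1] at h2
    simpa using y.2.1.injective h2
  · rw [two_mul, add_assoc, zpow_add, Equiv.Perm.mul_apply, EmbeddingLike.apply_eq_iff_eq,
      add_comm, zpow_one_add, Equiv.Perm.mul_apply, ← hy] at h1
    obtain ⟨p, hp, -, -, h2, -⟩ := exists_adj_turn hT y
    rw [← h1, reverse_two] at h2
    rw [← h1] at hp
    exact T.adj_irrefl _ _ _ hp h2.symm

/-- Turning through glued triangles carries the edge of a flag along. -/
theorem carries_turn_pow {R : Set T.Simplex} (x : Flag K) (k : ℕ)
    (h : ∀ j < k, flagTriangle T ((turn hT ^ j) x) ∈ R) :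
    ∃ q, (T.restrict R).Carries {x.2.1 0, x.2.1 1} x.1 ((turn hT ^ k) x).1 q ∧
      q (x.2.1 0) = ((turn hT ^ k) x).2.1 0 ∧ q (x.2.1 1) = ((turn hT ^ k) x).2.1 1 := by
  induction k with
  | zero => exact ⟨1, .refl, rfl, rfl⟩
  | succ k ih =>
    obtain ⟨q, hq, h0, h1⟩ := ih fun j hj => h j (by omega)
    have hk := h k (by omega)
    rw [pow_succ', Equiv.Perm.mul_apply]
    set z := (turn hT ^ k) x
    obtain ⟨p, hp, h0', h1', -, -⟩ := exists_adj_turn hT z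
    refine ⟨p * q, hq.cross ?_ (restrict_adj_eq_some.2 ⟨hk, hp⟩), ?_, ?_⟩
    · simp [h0, h1]
    · simp [h0, h0']
    · simp [h1, h1']

/-- A walk around the edge of the flag `y` that cannot leave it backwards only turns forwards. -/
theorem exists_pow_of_carries {R : Set T.Simplex} {y : Flag K}
    (hy : T.image (localTriangle y.1 (y.2.1 2)) ∉ R) {u : K} {q : Equiv.Perm (Fin 4)}
    (h : (T.restrict R).Carries {y.2.1 0, y.2.1 1} y.1 u q) :
    ∃ k, (∀ j < k, flagTriangle T ((turn hT ^ j) y) ∈ R) ∧ ((turn hT ^ k) y).1 = u ∧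
      ((turn hT ^ k) y).2.1 0 = q (y.2.1 0) ∧ ((turn hT ^ k) y).2.1 1 = q (y.2.1 1) := by
  induction h with
  | refl => exact ⟨0, by simp, rfl, rfl, rfl⟩
  | @cross v w q r i _ hi hadj ih =>
    obtain ⟨k, hk, rfl, h0, h1⟩ := ih
    obtain ⟨hR, hadj⟩ := restrict_adj_eq_some.1 hadj
    rcases perm_eq_two_or_three (f := ((turn hT ^ k) y).2.1) (i := i)
      (h0 ▸ hi _ (by simp)) (h1 ▸ hi _ (by simp)) with rfl | rfl
    · rcases k with _ | k
      · exact absurd hR hy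
      · rw [pow_succ', Equiv.Perm.mul_apply] at h0 h1 hadj
        refine ⟨k, fun j hj => hk j (by omega), ?_⟩
        obtain ⟨p, hp, h0', h1', h2', -⟩ := exists_adj_turn hT ((turn hT ^ k) y)
        have := T.adj_symm _ _ _ _ hp
        rw [← h2', hadj, Option.some.injEq, Prod.mk.injEq] at this
        obtain ⟨rfl, rfl⟩ := this
        refine ⟨rfl, ?_, ?_⟩
        · simp [← h0, h0']
        · simp [← h1, h1']
    · refine ⟨k + 1, ?_, ?_⟩
      · intro j hj
        rcases Nat.lt_succ_iff_lt_or_eq.1 hj with hj | rfl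
        · exact hk j hj
        · exact hR
      · rw [pow_succ', Equiv.Perm.mul_apply]
        obtain ⟨p, hp, h0', h1', -, -⟩ := exists_adj_turn hT ((turn hT ^ k) y)
        rw [hadj, Option.some.injEq, Prod.mk.injEq] at hp
        obtain ⟨h3, rfl⟩ := hp
        exact ⟨h3.symm, by simp [h0', h0], by simp [h1', h1]⟩

theorem exists_sameCycle_of_carries (y : Flag K) {u : K} {q : Equiv.Perm (Fin 4)}
    (h : T.Carries {y.2.1 0, y.2.1 1} y.1 u q) :
    ∃ z, (turn hT).SameCycle y z ∧ z.1 = u ∧ z.2.1 0 = q (y.2.1 0) ∧ z.2.1 1 = q (y.2.1 1) := by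
  induction h with
  | refl => exact ⟨y, .rfl, rfl, rfl, rfl⟩
  | @cross v w q r i _ hi hadj ih =>
    obtain ⟨z, hz, rfl, h0, h1⟩ := ih
    rcases perm_eq_two_or_three (f := z.2.1) (i := i)
      (h0 ▸ hi _ (by simp)) (h1 ▸ hi _ (by simp)) with rfl | rfl
    · obtain ⟨x, rfl⟩ := (turn hT).surjective z
      refine ⟨x, Equiv.Perm.sameCycle_apply_right.1 hz, ?_⟩
      obtain ⟨p, hp, h0', h1', h2', -⟩ := exists_adj_turn hT x
      have := T.adj_symm _ _ _ _ hp
      rw [← h2', hadj, Option.some.injEq, Prod.mk.injEq] at this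
      obtain ⟨rfl, rfl⟩ := this
      refine ⟨rfl, ?_, ?_⟩
      · simp [← h0, h0']
      · simp [← h1, h1']
    · refine ⟨turn hT z, Equiv.Perm.sameCycle_apply_right.2 hz, ?_⟩
      obtain ⟨p, hp, h0', h1', -, -⟩ := exists_adj_turn hT z
      rw [hadj, Option.some.injEq, Prod.mk.injEq] at hp
      obtain ⟨h3, rfl⟩ := hp
      exact ⟨h3.symm, by simp [h0', h0], by simp [h1', h1]⟩

theorem image_flagEdge_turn (x : Flag K) :
    T.image (flagEdge (turn hT x)) = T.image (flagEdge x) := by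
  obtain ⟨p, hp, h0, h1, -, -⟩ := exists_adj_turn hT x
  refine (image_eq_iff.2 ⟨p, ?_, ?_⟩).symm
  · have := Carries.cross (A := {x.2.1 0, x.2.1 1}) .refl (by simp) hp
    rwa [mul_one] at this
  · simp [flagEdge, localEdge, h0, h1]

theorem image_flagEdge_eq_of_sameCycle {x z : Flag K} (h : (turn hT).SameCycle x z) :
    T.image (flagEdge z) = T.image (flagEdge x) :=
  (sameCycle_setoid_le_ker (f := fun x => T.image (flagEdge x)) (image_flagEdge_turn hT) h).symm

theorem exists_sameCycle_of_image_eq {x : Flag K} {l : LocalSimplex K}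
    (h : T.image l = T.image (flagEdge x)) :
    ∃ z, (turn hT).SameCycle x z ∧ l = flagEdge z := by
  obtain ⟨q, hq, hmap⟩ := image_eq_iff.1 h.symm
  obtain ⟨z, hz, ht, h0, h1⟩ := exists_sameCycle_of_carries hT x hq
  refine ⟨z, hz, LocalSimplex.ext ht.symm ?_⟩
  rw [← hmap]
  simp [flagEdge, localEdge, h0, h1]

end turn

/-! ### Gluing steps and free faces -/

theorem flag_ne (x : Flag K) {i j : Fin 4} (hij : i ≠ j) : x.2.1 i ≠ x.2.1 j :=
  fun h => hij (x.2.1.injective h)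

/-- All the triangles around the edge of the flag `x` are in `R`, with the possible exception of the
triangle crossed when turning from `x`. -/
def OnlyGap (hT : T.IsClosed) (R : Set T.Simplex) (x : Flag K) : Prop :=
  ∀ z, (turn hT).SameCycle x z → flagTriangle T z ∈ R ∨ z = x

theorem OnlyGap.exists_pow [Finite K] {hT : T.IsClosed} {R : Set T.Simplex} {x : Flag K}
    (h : OnlyGap hT R x) : ∃ m, (∀ j < m, flagTriangle T ((turn hT ^ j) (turn hT x)) ∈ R) ∧
      (turn hT ^ m) (turn hT x) = x := by
  classical
  have hpow : ∀ k, (turn hT ^ k) (turn hT x) = (turn hT ^ (k + 1)) x := fun k => by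
    rw [pow_succ, Equiv.Perm.mul_apply]
  have hex : ∃ m, (turn hT ^ m) (turn hT x) = x := by
    refine ⟨orderOf (turn hT) - 1, ?_⟩
    rw [hpow, Nat.sub_add_cancel (orderOf_pos (turn hT)), pow_orderOf_eq_one]
    rfl
  refine ⟨Nat.find hex, fun j hj => ?_, Nat.find_spec hex⟩
  refine (h _ ?_).resolve_right (Nat.find_min hex hj)
  rw [hpow]
  exact ⟨((j + 1 : ℕ) : ℤ), by rw [zpow_natCast]⟩

theorem exists_pow_le_of_pow_turn_eq [Finite K] {hT : T.IsClosed} {x : Flag K} {m : ℕ}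
    (hx : (turn hT ^ m) (turn hT x) = x) {z : Flag K} (hz : (turn hT).SameCycle x z) :
    ∃ j ≤ m, (turn hT ^ j) (turn hT x) = z := by
  obtain ⟨i, -, hi⟩ := (Equiv.Perm.sameCycle_apply_left.2 hz).exists_pow_eq'
  have hper : (turn hT ^ (m + 1)) (turn hT x) = turn hT x := by
    rw [pow_succ', Equiv.Perm.mul_apply, hx]
  have hper' : ∀ n, ((turn hT ^ (m + 1)) ^ n) (turn hT x) = turn hT x := by
    intro n
    induction n with
    | zero => rfl
    | succ n ih => rw [pow_succ, Equiv.Perm.mul_apply, hper, ih]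
  refine ⟨i % (m + 1), Nat.lt_succ_iff.1 (Nat.mod_lt _ (by omega)), ?_⟩
  rw [← hi]
  conv_rhs => rw [← Nat.mod_add_div i (m + 1), pow_add, Equiv.Perm.mul_apply, pow_mul, hper']

/-- The two copies, in `T.restrict R`, of a side of a triangle that is not in `R` coincide if and
only if this side is the only gap around the corresponding edge. -/
theorem onlyGap_iff_carries [Finite K] (hT : T.IsClosed) {R : Set T.Simplex} {x : Flag K}
    (hx : flagTriangle T x ∉ R) :
    OnlyGap hT R x ↔ ∃ q, (T.restrict R).Carries {x.2.1 0, x.2.1 1} x.1 (turn hT x).1 q ∧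
      q (x.2.1 0) = (turn hT x).2.1 0 ∧ q (x.2.1 1) = (turn hT x).2.1 1 := by
  constructor
  · intro h
    obtain ⟨m, hm, hx'⟩ := h.exists_pow
    obtain ⟨q, hq, h0, h1⟩ := carries_turn_pow hT (turn hT x) m hm
    rw [hx'] at hq h0 h1
    refine ⟨q⁻¹, ?_, by simp [← h0], by simp [← h1]⟩
    simpa [h0, h1] using hq.symm
  · rintro ⟨q, hq, h0, h1⟩ z hz
    have hq' : (T.restrict R).Carries {(turn hT x).2.1 0, (turn hT x).2.1 1} (turn hT x).1
        x.1 q⁻¹ := by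
      simpa [h0, h1] using hq.symm
    obtain ⟨k, hk, ht, h0', h1'⟩ := exists_pow_of_carries hT
      (by rwa [image_localTriangle_turn]) hq'
    have hx' : (turn hT ^ k) (turn hT x) = x :=
      Flag.ext_edge ht (by simp [h0', ← h0]) (by simp [h1', ← h1])
    obtain ⟨j, hj, rfl⟩ := exists_pow_le_of_pow_turn_eq hx' hz
    rcases hj.lt_or_eq with hj | rfl
    · exact .inl (hk j hj)
    · exact .inr hx'

/-- If the edge of `x` has only one gap, its copies in the tetrahedra are all identified already in
`T.restrict R`. -/
theorem OnlyGap.image_eq_iff [Finite K] {hT : T.IsClosed} {R : Set T.Simplex} {x : Flag K}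
    (h : OnlyGap hT R x) (l : LocalSimplex K) :
    (T.restrict R).image l = (T.restrict R).image (flagEdge x) ↔
      T.image l = T.image (flagEdge x) := by
  refine ⟨image_eq_of_le (T.restrict_le R), fun hl => ?_⟩
  obtain ⟨z, hz, rfl⟩ := exists_sameCycle_of_image_eq hT hl
  obtain ⟨m, hm, hx⟩ := h.exists_pow
  have key : ∀ j ≤ m, (T.restrict R).image (flagEdge ((turn hT ^ j) (turn hT x))) =
      (T.restrict R).image (flagEdge (turn hT x)) := by
    intro j hj
    obtain ⟨q, hq, h0, h1⟩ := carries_turn_pow hT (turn hT x) j fun i hi => hm i (by omega)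
    exact (TetGluing.image_eq_iff.2 ⟨q, hq, by simp [flagEdge, localEdge, h0, h1]⟩).symm
  obtain ⟨j, hj, rfl⟩ := exists_pow_le_of_pow_turn_eq hx hz
  rw [key j hj, ← key m le_rfl, hx]

/-- The edge `σ` is a free face of the triangle `τ` in the 2-complex of the triangles that are not
in `R`. -/
structure IsFreeFace (T : TetGluing K) (R : Set T.Simplex) (σ τ : T.Simplex) : Prop where
  dim_small : σ.dim = 1
  dim_big : τ.dim = 2
  notMem : τ ∉ R
  once : T.IsFaceOnce σ τ
  free : ∀ ρ, ρ.dim = 2 → ρ ∉ R → T.IsFace σ ρ → ρ = τ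

theorem restrict_insert_adj {R : Set T.Simplex} {τ : T.Simplex} {t : K} {i : Fin 4}
    (h : T.image (localTriangle t i) ≠ τ) :
    (T.restrict (insert τ R)).adj t i = (T.restrict R).adj t i := by
  simp only [restrict]
  split_ifs with h1 h2 h2
  · rfl
  · exact absurd (h1.resolve_left h) h2
  · exact absurd (.inr h2) h1
  · rfl

theorem isFace_flagTriangle (T : TetGluing K) (x : Flag K) :
    T.IsFace (T.image (flagEdge x)) (flagTriangle T x) := by
  refine ⟨flagEdge x, localTriangle x.1 (x.2.1 3), rfl, ?_, rfl, rfl⟩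
  intro a ha
  simp only [flagEdge, localEdge, Finset.mem_insert, Finset.mem_singleton] at ha
  simp only [localTriangle, Finset.mem_compl, Finset.mem_singleton]
  rcases ha with rfl | rfl <;> exact flag_ne x (by decide)

theorem flagEdge_subset_iff {x : Flag K} {t : K} {i : Fin 4} :
    (flagEdge x).verts ⊆ (localTriangle t i).verts ↔ i = x.2.1 2 ∨ i = x.2.1 3 := by
  constructor
  · intro h
    refine perm_eq_two_or_three ?_ ?_
    · simpa [localTriangle] using h (show x.2.1 0 ∈ _ by simp [flagEdge, localEdge])
    · simpa [localTriangle] using h (show x.2.1 1 ∈ _ by simp [flagEdge, localEdge])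
  · intro h a ha
    simp only [flagEdge, localEdge, Finset.mem_insert, Finset.mem_singleton] at ha
    simp only [localTriangle, Finset.mem_compl, Finset.mem_singleton]
    rcases ha with rfl | rfl <;> rcases h with rfl | rfl <;> exact flag_ne x (by decide)

theorem flagEdge_injOn {x z : Flag K} (h : flagEdge z = flagEdge x)
    (h3 : z.2.1 3 = x.2.1 3) : z = x := by
  rcases eq_or_eq_reverse_of_flagEdge_eq h with h | h
  · exact h
  · rw [h, reverse_three] at h3
    exact absurd h3 (flag_ne x (by decide))

/-- The edge of `x` is a free face of the triangle of `x` if and only if this triangle has the only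
gap around the edge. -/
theorem onlyGap_iff_isFreeFace (hT : T.IsClosed) {R : Set T.Simplex} {x : Flag K}
    (hx : flagTriangle T x ∉ R) :
    OnlyGap hT R x ↔ T.IsFreeFace R (T.image (flagEdge x)) (flagTriangle T x) := by
  constructor
  · intro h
    refine ⟨dim_localEdge _ _ (flag_ne x (by decide)), dim_localTriangle _ _ _, hx, ?_, ?_⟩
    · refine ⟨localTriangle x.1 (x.2.1 3), rfl, flagEdge x,
        ⟨rfl, flagEdge_subset_iff.2 (.inr rfl), rfl⟩, ?_⟩
      rintro l ⟨ht, hl, hσ⟩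
      obtain ⟨z, hz, rfl⟩ := exists_sameCycle_of_image_eq hT hσ
      change z.1 = x.1 at ht
      rcases flagEdge_subset_iff.1 hl with h2 | h3
      · obtain ⟨w, rfl⟩ := (turn hT).surjective z
        have hw : flagTriangle T w = flagTriangle T x := by
          rw [← image_localTriangle_turn hT, ← h2, ht, flagTriangle]
        rcases h w (Equiv.Perm.sameCycle_apply_right.1 hz) with hR | rfl
        · exact absurd (hw ▸ hR) hx
        · obtain ⟨p, hp, -, -, hp2, -⟩ := exists_adj_turn hT w
          rw [ht] at hp
          exact absurd (hp2.symm.trans h2.symm) (T.adj_irrefl _ _ _ hp)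
      · have hz' : flagTriangle T z = flagTriangle T x := by
          rw [flagTriangle, ← h3, ht, flagTriangle]
        rcases h z hz with hR | rfl
        · exact absurd (hz' ▸ hR) hx
        · rfl
    · rintro ρ hρ hρR ⟨l, m, ht, hlm, hl, rfl⟩
      obtain ⟨z, hz, rfl⟩ := exists_sameCycle_of_image_eq hT hl
      obtain ⟨i, hi⟩ := eq_localTriangle hρ
      rw [← ht] at hi
      subst hi
      rcases flagEdge_subset_iff.1 hlm with rfl | rfl
      · obtain ⟨w, rfl⟩ := (turn hT).surjective z
        change T.image (localTriangle (turn hT w).1 _) ∉ R at hρR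
        change T.image (localTriangle (turn hT w).1 _) = _
        rw [image_localTriangle_turn] at hρR ⊢
        rw [(h w (Equiv.Perm.sameCycle_apply_right.1 hz)).resolve_left hρR]
      · rw [← (h z hz).resolve_left hρR]
        rfl
  · intro h z hz
    by_contra! hcon
    obtain ⟨hzR, hzx⟩ := hcon
    have hσ := image_flagEdge_eq_of_sameCycle hT hz
    have hτ : flagTriangle T z = flagTriangle T x :=
      h.free _ (dim_localTriangle _ _ _) hzR (hσ ▸ isFace_flagTriangle T z)
    rcases image_localTriangle_eq_iff.1 hτ.symm with ⟨ht, h3⟩ | ⟨p, hp, h3⟩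
    · refine hzx (flagEdge_injOn ?_ h3)
      exact h.once.eq ht (flagEdge_subset_iff.2 (.inr h3.symm)) hσ rfl
        (flagEdge_subset_iff.2 (.inr rfl)) rfl
    · -- The triangle of `z` is glued to the triangle of `x`.
      obtain ⟨p', hp', -, -, h2', -⟩ := exists_adj_turn hT x
      rw [hp, Option.some.injEq, Prod.mk.injEq] at hp'
      obtain ⟨ht, rfl⟩ := hp'
      rw [h3] at h2'
      have honce := h.once
      rw [← hτ] at honce
      have hE : flagEdge z = flagEdge (turn hT x) :=
        honce.eq rfl (flagEdge_subset_iff.2 (.inr rfl)) hσ ht.symm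
          (flagEdge_subset_iff.2 (.inl h2'.symm)) (image_flagEdge_turn hT x)
      rcases eq_or_eq_reverse_of_flagEdge_eq hE with hz' | hz'
      · rw [hz'] at h2'
        exact flag_ne _ (by decide) h2'
      · refine not_sameCycle_reverse hT (turn hT x) ?_
        rw [← hz']
        exact Equiv.Perm.sameCycle_apply_left.2 hz

theorem exists_flag_of_isFace {σ τ : T.Simplex} (hσ : σ.dim = 1) (hτ : τ.dim = 2)
    (h : T.IsFace σ τ) : ∃ x, T.image (flagEdge x) = σ ∧ flagTriangle T x = τ := by
  obtain ⟨l, m, ht, hlm, rfl, rfl⟩ := h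
  obtain ⟨a, b, hab, hl⟩ := eq_localEdge hσ
  obtain ⟨i, hi⟩ := eq_localTriangle hτ
  obtain ⟨x, hx, h0, h1⟩ := exists_flagEdge_eq l.tet hab
  have hlx : l = flagEdge x := by rw [hl, flagEdge, hx, h0, h1]
  rw [← ht] at hi
  rw [hi, hlx] at hlm
  rw [hlx]
  rcases flagEdge_subset_iff.1 hlm with rfl | rfl
  · refine ⟨reverse x, by rw [flagEdge_reverse], ?_⟩
    rw [hi, flagTriangle, reverse_three, ← hx]
    rfl
  · refine ⟨x, rfl, ?_⟩
    rw [hi, flagTriangle, hx]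

theorem exists_flag_of_ne (t : K) {a b i : Fin 4} (hab : a ≠ b) (ha : a ≠ i) (hb : b ≠ i) :
    ∃ x : Flag K, x.1 = t ∧ x.2.1 3 = i ∧
      (x.2.1 0 = a ∧ x.2.1 1 = b ∨ x.2.1 0 = b ∧ x.2.1 1 = a) := by
  obtain ⟨x, hx, h0, h1⟩ := exists_flagEdge_eq t hab
  rcases perm_eq_two_or_three (h0 ▸ ha) (h1 ▸ hb) with h | h
  · refine ⟨reverse x, hx, by rw [reverse_three, h], .inr ⟨?_, ?_⟩⟩
    · rw [reverse_zero, h1]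
    · rw [reverse_one, h0]
  · exact ⟨x, hx, h.symm, .inl ⟨h0, h1⟩⟩

/-- A gluing step inside `T` glues the two copies of a triangle along the only gap of an edge. -/
theorem IsGluingStep.exists_flag [Finite K] (hT : T.IsClosed) {R : Set T.Simplex}
    {e : (T.restrict R).Simplex} {G' : TetGluing K} (h : (T.restrict R).IsGluingStep e G')
    (hle : G'.Le T) : ∃ x : Flag K, flagTriangle T x ∉ R ∧ OnlyGap hT R x ∧
      e = (T.restrict R).image (flagEdge x) ∧ G' = T.restrict (insert (flagTriangle T x) R) := by
  obtain ⟨t, t', i, a, b, p, hab, ha, hb, -, hn, -, rfl, ⟨q, hq, hqa, hqb⟩, h1, h2, h3⟩ := h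
  obtain ⟨x, rfl, rfl, hx⟩ := exists_flag_of_ne t hab ha hb
  have hp := hle _ _ _ h1
  obtain ⟨p', hp', hp0, hp1, -, -⟩ := exists_adj_turn hT x
  rw [hp, Option.some.injEq, Prod.mk.injEq] at hp'
  obtain ⟨rfl, rfl⟩ := hp'
  have hxR : flagTriangle T x ∉ R := (restrict_adj_eq_none hT).1 hn
  refine ⟨x, hxR, (onlyGap_iff_carries hT hxR).2 ⟨q, ?_⟩, ?_, ?_⟩
  · rcases hx with ⟨rfl, rfl⟩ | ⟨rfl, rfl⟩
    · exact ⟨hq, hqa.trans hp0.symm, hqb.trans hp1.symm⟩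
    · rw [Finset.pair_comm] at hq
      exact ⟨hq, hqb.trans hp0.symm, hqa.trans hp1.symm⟩
  · rcases hx with ⟨rfl, rfl⟩ | ⟨rfl, rfl⟩
    · rfl
    · rw [localEdge_comm]
      rfl
  · ext1
    funext u j
    by_cases huj : T.image (localTriangle u j) = flagTriangle T x
    · have hmem : (T.restrict (insert (flagTriangle T x) R)).adj u j = T.adj u j := by
        simp [restrict, huj]
      rw [hmem]
      rcases image_localTriangle_eq_iff.1 huj.symm with ⟨rfl, rfl⟩ | ⟨r, hr, rfl⟩
      · rw [h1, hp]
      · rw [hp, Option.some.injEq, Prod.mk.injEq] at hr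
        obtain ⟨rfl, rfl⟩ := hr
        rw [h2, T.adj_symm _ _ _ _ hp]
    · rw [h3 u j]
      · exact (restrict_insert_adj huj).symm
      · rintro ⟨⟩
        exact huj rfl
      · rintro ⟨⟩
        exact huj (T.image_localTriangle_eq hp).symm

theorem OnlyGap.isGluingStep [Finite K] {hT : T.IsClosed} {R : Set T.Simplex} {x : Flag K}
    (hx : flagTriangle T x ∉ R) (h : OnlyGap hT R x) :
    (T.restrict R).IsGluingStep ((T.restrict R).image (flagEdge x))
      (T.restrict (insert (flagTriangle T x) R)) := by
  obtain ⟨p, hp, h0, h1, -, -⟩ := exists_adj_turn hT x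
  obtain ⟨q, hq, hq0, hq1⟩ := (onlyGap_iff_carries hT hx).1 h
  have himg := T.image_localTriangle_eq hp
  refine ⟨x.1, (turn hT x).1, x.2.1 3, x.2.1 0, x.2.1 1, p, flag_ne x (by decide),
    flag_ne x (by decide), flag_ne x (by decide), ?_, (restrict_adj_eq_none hT).2 hx,
    (restrict_adj_eq_none hT).2 ?_, rfl, ⟨q, hq, hq0.trans h0, hq1.trans h1⟩,
    restrict_adj_eq_some.2 ⟨.inl rfl, hp⟩,
    restrict_adj_eq_some.2 ⟨.inl himg.symm, T.adj_symm _ _ _ _ hp⟩, ?_⟩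
  · intro heq
    rw [Prod.mk.injEq] at heq
    rw [← heq.1] at hp
    exact T.adj_irrefl _ _ _ hp heq.2.symm
  · rwa [← himg]
  · intro u j h1 h2
    have huj : T.image (localTriangle u j) ≠ flagTriangle T x := by
      intro huj
      rcases image_localTriangle_eq_iff.1 huj.symm with ⟨rfl, rfl⟩ | ⟨r, hr, rfl⟩
      · exact h1 rfl
      · rw [hp, Option.some.injEq, Prod.mk.injEq] at hr
        exact h2 (Prod.ext hr.1.symm (by rw [hr.2]))
    exact restrict_insert_adj huj

/-- A gluing step inside `T` glues the copies of a triangle around a free face of the triangle, and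
the chosen edge is made of all the copies of this free face. -/
theorem IsGluingStep.exists_isFreeFace [Finite K] (hT : T.IsClosed) {R : Set T.Simplex}
    {G G' : TetGluing K} {e : G.Simplex} (h : G.IsGluingStep e G') (hG : G = T.restrict R)
    (hle : G'.Le T) : ∃ σ τ, T.IsFreeFace R σ τ ∧ G' = T.restrict (insert τ R) ∧
      ∀ l, G.image l = e ↔ T.image l = σ := by
  subst hG
  obtain ⟨x, hx, hgap, rfl, hG⟩ := h.exists_flag hT hle
  exact ⟨_, _, (onlyGap_iff_isFreeFace hT hx).1 hgap, hG, hgap.image_eq_iff⟩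

/-- The two copies of a triangle can be glued around a free face of the triangle. -/
theorem IsFreeFace.exists_isGluingStep [Finite K] (hT : T.IsClosed) {R : Set T.Simplex}
    {σ τ : T.Simplex} (h : T.IsFreeFace R σ τ) :
    ∃ e, (T.restrict R).IsGluingStep e (T.restrict (insert τ R)) ∧
      ∀ l, (T.restrict R).image l = e ↔ T.image l = σ := by
  obtain ⟨x, rfl, rfl⟩ := exists_flag_of_isFace h.dim_small h.dim_big h.once.isFace
  have hgap := (onlyGap_iff_isFreeFace hT h.notMem).2 h
  exact ⟨_, hgap.isGluingStep h.notMem, hgap.image_eq_iff⟩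

/-! ### Counting the simplices of a closed triangulation -/

instance [Finite K] : Finite (LocalSimplex K) :=
  Finite.of_injective (fun x : LocalSimplex K => (x.tet, x.verts)) fun _ _ h =>
    LocalSimplex.ext (congrArg Prod.fst h) (congrArg Prod.snd h)

instance [Finite K] : Finite T.Simplex :=
  Quotient.finite T.simplexSetoid

/-- The 3-cycle that rotates the last three vertices of a flag. -/
def rotation : alternatingGroup (Fin 4) :=
  ⟨Equiv.swap 2 3 * Equiv.swap 1 2, Equiv.Perm.mem_alternatingGroup.2 (by decide)⟩

/-- Crossing a triangle next to a vertex. The flags at a vertex are the darts of a map drawn on the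
link of this vertex; its edges are given by this involution, its faces (the corners of the
tetrahedra) by the cycles of `rotation`, and its vertices by the cycles of `turn`. -/
def linkEdge (hT : T.IsClosed) : Equiv.Perm (Flag K) := reorder rotation * turn hT

theorem exists_adj_linkEdge (hT : T.IsClosed) (x : Flag K) :
    ∃ p, T.adj x.1 (x.2.1 3) = some ((linkEdge hT x).1, p) ∧
      (linkEdge hT x).2.1 0 = p (x.2.1 0) ∧ (linkEdge hT x).2.1 1 = p (x.2.1 2) ∧
      (linkEdge hT x).2.1 2 = p (x.2.1 1) ∧ (linkEdge hT x).2.1 3 = p (x.2.1 3) := by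
  obtain ⟨p, hp, h0, h1, h2, h3⟩ := exists_adj_turn hT x
  refine ⟨p, hp, ?_, ?_, ?_, ?_⟩
  · rw [← h0]
    change (turn hT x).2.1 (rotation.1 0) = _
    congr 1
  · rw [← h3]
    change (turn hT x).2.1 (rotation.1 1) = _
    congr 1
  · rw [← h1]
    change (turn hT x).2.1 (rotation.1 2) = _
    congr 1
  · rw [← h2]
    change (turn hT x).2.1 (rotation.1 3) = _
    congr 1

theorem linkEdge_linkEdge (hT : T.IsClosed) (x : Flag K) : linkEdge hT (linkEdge hT x) = x := by
  obtain ⟨p, hp, h0, h1, h2, h3⟩ := exists_adj_linkEdge hT x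
  obtain ⟨q, hq, h0', h1', -, -⟩ := exists_adj_linkEdge hT (linkEdge hT x)
  rw [h3, T.adj_symm _ _ _ _ hp, Option.some.injEq, Prod.mk.injEq] at hq
  obtain ⟨ht, rfl⟩ := hq
  exact Flag.ext_edge ht.symm (by simp [h0', h0]) (by simp [h1', h2])

theorem exists_even_perm_zero_three : ∀ {a i : Fin 4}, a ≠ i →
    ∃ f : alternatingGroup (Fin 4), f.1 0 = a ∧ f.1 3 = i := by
  have : ∀ a i : Fin 4, a ≠ i →
    ∃ f : Equiv.Perm (Fin 4), Equiv.Perm.sign f = 1 ∧ f 0 = a ∧ f 3 = i := by decide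
  intro a i h
  obtain ⟨f, hf, h⟩ := this a i h
  exact ⟨⟨f, Equiv.Perm.mem_alternatingGroup.2 hf⟩, h⟩

theorem eq_rotation_pow {f : alternatingGroup (Fin 4)} (h : f.1 0 = 0) :
    ∃ n : ℕ, f = rotation ^ n := by
  have key : ∀ f : Equiv.Perm (Fin 4), Equiv.Perm.sign f = 1 → f 0 = 0 →
      f = 1 ∨ f = Equiv.swap 2 3 * Equiv.swap 1 2 ∨
        f = (Equiv.swap 2 3 * Equiv.swap 1 2) * (Equiv.swap 2 3 * Equiv.swap 1 2) := by
    decide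
  rcases key f.1 f.2 h with h | h | h
  · exact ⟨0, Subtype.ext (by rw [h, pow_zero]; rfl)⟩
  · exact ⟨1, Subtype.ext (by rw [h, pow_one]; rfl)⟩
  · exact ⟨2, Subtype.ext (by rw [h, pow_two]; rfl)⟩

theorem sameCycle_reorder_of_vertex_eq {x y : Flag K} (ht : x.1 = y.1)
    (h0 : x.2.1 0 = y.2.1 0) :
    (reorder rotation⁻¹ : Equiv.Perm (Flag K)).SameCycle x y := by
  obtain ⟨n, hn⟩ := eq_rotation_pow (f := y.2⁻¹ * x.2) (by simp [h0])
  have key : ∀ n : ℕ, ∀ z : Flag K,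
      ((reorder rotation⁻¹) ^ n) z = (z.1, z.2 * (rotation ^ n)⁻¹) := by
    intro n z
    induction n with
    | zero => simp
    | succ n ih =>
      rw [pow_succ', Equiv.Perm.mul_apply, ih]
      change (z.1, z.2 * (rotation ^ n)⁻¹ * rotation⁻¹) = _
      rw [pow_succ', mul_inv_rev, mul_assoc]
  refine ⟨n, ?_⟩
  rw [zpow_natCast, key, ← hn]
  exact Prod.ext ht (by simp)

/-- Two flags at the same vertex of `T` belong to the same component of the links. -/
theorem rel_of_image_localVertex_eq (hT : T.IsClosed) {x y : Flag K}
    (h : T.image (localVertex x.1 (x.2.1 0)) = T.image (localVertex y.1 (y.2.1 0))) :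
    (Equiv.Perm.SameCycle.setoid (reorder rotation⁻¹) ⊔
      Equiv.Perm.SameCycle.setoid (linkEdge hT)) x y := by
  set r := Equiv.Perm.SameCycle.setoid (reorder (K := K) rotation⁻¹) ⊔
      Equiv.Perm.SameCycle.setoid (linkEdge hT) with hr
  have hle1 : Equiv.Perm.SameCycle.setoid (reorder (K := K) rotation⁻¹) ≤ r := le_sup_left
  have hle2 : Equiv.Perm.SameCycle.setoid (linkEdge hT) ≤ r := le_sup_right
  have key : ∀ {u : K} {q : Equiv.Perm (Fin 4)}, T.Carries {x.2.1 0} x.1 u q →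
      ∀ y : Flag K, y.1 = u → y.2.1 0 = q (x.2.1 0) → r x y := by
    intro u q hc
    induction hc with
    | refl => exact fun y hy h0 => hle1 (sameCycle_reorder_of_vertex_eq hy.symm h0.symm)
    | @cross v w q p i _ hi hadj ih =>
      intro y hy h0
      obtain ⟨f, hf0, rfl⟩ := exists_even_perm_zero_three (hi _ (Finset.mem_singleton_self _))
      refine r.trans' (ih (v, f) rfl hf0) (r.trans' (y := linkEdge hT (v, f)) (hle2 ?_) (hle1 ?_))
      · exact ⟨1, by simp⟩
      · obtain ⟨p', hp', h0', -⟩ := exists_adj_linkEdge hT (v, f)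
        rw [hadj, Option.some.injEq, Prod.mk.injEq] at hp'
        obtain ⟨ht, rfl⟩ := hp'
        refine sameCycle_reorder_of_vertex_eq (ht.symm.trans hy.symm) ?_
        rw [h0', h0, Equiv.Perm.mul_apply, ← hf0]
  obtain ⟨q, hq, hmap⟩ := image_eq_iff.1 h
  refine key hq y rfl ?_
  simpa [localVertex] using hmap.symm

/-- A closed triangulation has at most as many edges as vertices and tetrahedra together: the sum of
the Euler characteristics of the links of the vertices is at most twice the number of vertices. -/
theorem card_edges_le [Finite K] (hT : T.IsClosed) :
    Nat.card {c : T.Simplex // c.dim = 1} ≤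
      Nat.card {c : T.Simplex // c.dim = 0} + Nat.card K := by
  have hgenus := cycleCount_add_le (reorder rotation⁻¹) (linkEdge hT) (linkEdge_linkEdge hT)
  have hmul : reorder rotation⁻¹ * linkEdge hT = turn hT := by
    ext1 x
    exact Prod.ext rfl (mul_inv_cancel_right _ _)
  have hcard : Nat.card (Flag K) = Nat.card K * 12 := by
    rw [Nat.card_prod, nat_card_alternatingGroup, Nat.card_eq_fintype_card (α := Fin 4),
      Fintype.card_fin]
    rfl
  have hlink := card_le_two_mul_cycleCount (linkEdge hT) (linkEdge_linkEdge hT)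
  have hfaces : Nat.card K * 4 ≤ cycleCount (reorder (K := K) rotation⁻¹) := by
    have hinv : ∀ x : Flag K, ((reorder rotation⁻¹ x).1, (reorder rotation⁻¹ x).2.1 0) =
        (x.1, x.2.1 0) := by
      intro x
      refine Prod.ext rfl ?_
      change x.2.1 ((rotation⁻¹).1 0) = _
      congr 1
    have := Nat.card_le_card_of_surjective
      (Quotient.lift (s := Equiv.Perm.SameCycle.setoid (reorder (K := K) rotation⁻¹))
        (fun x : Flag K => (x.1, x.2.1 0)) fun _ _ h =>
          sameCycle_setoid_le_ker (f := fun x : Flag K => (x.1, x.2.1 0)) hinv h) (by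
        rintro ⟨t, a⟩
        obtain ⟨x, rfl, rfl, -⟩ := exists_flagEdge_eq t (show a ≠ a + 1 by simp)
        exact ⟨Quotient.mk _ x, rfl⟩)
    rwa [Nat.card_prod, Nat.card_eq_fintype_card (α := Fin 4), Fintype.card_fin] at this
  have hverts : Nat.card (Quotient (Equiv.Perm.SameCycle.setoid (reorder (K := K) rotation⁻¹) ⊔
      Equiv.Perm.SameCycle.setoid (linkEdge hT))) ≤ Nat.card {c : T.Simplex // c.dim = 0} := by
    refine Nat.card_le_card_of_injective
      (fun c => ⟨T.image (localVertex c.out.1 (c.out.2.1 0)), dim_localVertex _ _ _⟩) ?_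
    intro c d hcd
    rw [← c.out_eq, ← d.out_eq]
    exact Quotient.sound (rel_of_image_localVertex_eq hT (congrArg Subtype.val hcd))
  have hedges : Nat.card {c : T.Simplex // c.dim = 1} * 2 ≤ cycleCount (turn hT) := by
    have hrep : ∀ c : {c : T.Simplex // c.dim = 1}, ∃ x, T.image (flagEdge x) = c.1 := by
      rintro ⟨c, hc⟩
      obtain ⟨l, rfl⟩ := exists_image_eq c
      obtain ⟨a, b, hab, hl⟩ := eq_localEdge hc
      obtain ⟨x, hx, rfl, rfl⟩ := exists_flagEdge_eq l.tet hab
      exact ⟨x, congrArg T.image (by rw [hl, flagEdge, hx])⟩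
    choose rep hrep using hrep
    -- The two orientations of an edge give two cycles.
    have := Nat.card_le_card_of_injective
      (fun p : {c : T.Simplex // c.dim = 1} × Bool =>
        Quotient.mk (Equiv.Perm.SameCycle.setoid (turn hT))
          (bif p.2 then reverse (rep p.1) else rep p.1)) (by
        rintro ⟨c, b⟩ ⟨d, b'⟩ h
        have h' : (turn hT).SameCycle _ _ := Quotient.exact h
        have himg := image_flagEdge_eq_of_sameCycle hT h'
        have hcd : d = c := by
          apply Subtype.ext
          cases b <;> cases b' <;> simpa [flagEdge_reverse, hrep] using himg
        subst hcd
        cases b <;> cases b'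
        · rfl
        · exact absurd h' (not_sameCycle_reverse hT _)
        · exact absurd h'.symm (not_sameCycle_reverse hT _)
        · rfl)
    rwa [Nat.card_prod, Nat.card_eq_fintype_card (α := Bool), Fintype.card_bool] at this
  rw [hmul] at hgenus
  omega

/-- Every triangle has at most two copies in the tetrahedra. -/
theorem two_mul_card_le_card_triangles [Finite K] (hT : T.IsClosed) :
    2 * Nat.card K ≤ Nat.card {c : T.Simplex // c.dim = 2} := by
  have hrep : ∀ c : {c : T.Simplex // c.dim = 2}, ∃ t i, T.image (localTriangle t i) = c.1 := by
    rintro ⟨c, hc⟩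
    obtain ⟨l, rfl⟩ := exists_image_eq c
    obtain ⟨i, hi⟩ := eq_localTriangle hc
    exact ⟨l.tet, i, congrArg T.image hi.symm⟩
  choose t i hrep using hrep
  have := Nat.card_le_card_of_surjective
    (fun p : {c : T.Simplex // c.dim = 2} × Bool =>
      bif p.2 then ((across hT (t p.1) (i p.1)).1, (across hT (t p.1) (i p.1)).2 (i p.1))
      else (t p.1, i p.1)) (by
      rintro ⟨u, j⟩
      have h := hrep ⟨T.image (localTriangle u j), dim_localTriangle _ _ _⟩
      rcases image_localTriangle_eq_iff.1 h with ⟨h1, h2⟩ | ⟨p, hp, h2⟩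
      · exact ⟨(⟨_, dim_localTriangle _ _ _⟩, false), Prod.ext h1.symm h2.symm⟩
      · refine ⟨(⟨_, dim_localTriangle T u j⟩, true), ?_⟩
        rw [adj_eq_across hT, Option.some.injEq, Prod.mk.injEq] at hp
        refine Prod.ext hp.1 ?_
        rw [← hp.2] at h2
        exact h2)
  rw [Nat.card_prod, Nat.card_prod, Nat.card_eq_fintype_card (α := Bool),
    Nat.card_eq_fintype_card (α := Fin 4), Fintype.card_bool, Fintype.card_fin] at this
  omega

end TetGluing

/-! ### Spanning trees and numbers of edges -/

/-- A spanning tree has fewer edges than there are vertices. The condition `hS` excludes elements of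
`S` that join nothing, which `IsSpanningTreeOf` would not detect. -/
theorem IsSpanningTreeOf.card_add_one_le {V E : Type*} [Finite V] {joins : E → V → V → Prop}
    {S : Set E} (h : IsSpanningTreeOf joins S)
    (hsymm : ∀ e u v, joins e u v → joins e v u) (hS : ∀ e ∈ S, ∃ u v, joins e u v) :
    Nat.card S + 1 ≤ Nat.card V := by
  have hcard := (SimpleGraph.isTree_iff_connected_and_card.1 h.isTree).2
  choose u v huv using hS
  have := Nat.card_le_card_of_injective
    (fun e : S => (⟨s(u e e.2, v e e.2), by
      rw [SimpleGraph.mem_edgeSet, SimpleGraph.fromRel_adj]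
      refine ⟨fun heq => h.loopless e e.2 (u e e.2) ?_, .inl ⟨e, e.2, huv e e.2⟩⟩
      have := huv e e.2
      rwa [← heq] at this⟩ :
        (SimpleGraph.fromRel fun u v => ∃ e ∈ S, joins e u v).edgeSet)) (by
    rintro ⟨e, he⟩ ⟨e', he'⟩ heq
    apply Subtype.ext
    have heq' := congrArg Subtype.val heq
    simp only [Sym2.eq_iff] at heq'
    refine h.noMultiple e he e' he' _ _ (huv e he) ?_
    rcases heq' with ⟨h1, h2⟩ | ⟨h1, h2⟩
    · rw [h1, h2]
      exact huv e' he'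
    · rw [h1, h2]
      exact hsymm _ _ _ (huv e' he'))
  rw [← hcard]
  exact Nat.succ_le_succ this

/-- A set of edges that connects all the vertices is a spanning tree if there are fewer edges than
vertices. -/
theorem isSpanningTreeOf_of_card {V E : Type*} [Finite V] {joins : E → V → V → Prop} {S : Set E}
    [Finite S] (hends : ∀ e u v u' v', joins e u v → joins e u' v' → s(u, v) = s(u', v'))
    (hconn : (SimpleGraph.fromRel fun u v => ∃ e ∈ S, joins e u v).Connected)
    (hcard : Nat.card S + 1 ≤ Nat.card V) : IsSpanningTreeOf joins S := by
  set G := SimpleGraph.fromRel fun u v => ∃ e ∈ S, joins e u v with hG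
  have hex : ∀ a : G.edgeSet, ∃ e : S, ∃ u v, u ≠ v ∧ a.1 = s(u, v) ∧ joins e u v := by
    rintro ⟨a, ha⟩
    induction a with | _ u v
    rw [SimpleGraph.mem_edgeSet, SimpleGraph.fromRel_adj] at ha
    obtain ⟨hne, ⟨e, he, hj⟩ | ⟨e, he, hj⟩⟩ := ha
    · exact ⟨⟨e, he⟩, u, v, hne, rfl, hj⟩
    · exact ⟨⟨e, he⟩, v, u, hne.symm, Sym2.eq_swap, hj⟩
  choose g u v hne ha hj using hex
  have hinj : Function.Injective g := by
    intro a b hab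
    have h1 := hj a
    rw [hab] at h1
    apply Subtype.ext
    rw [ha a, ha b]
    exact hends _ _ _ _ _ h1 (hj b)
  have hle := hconn.card_vert_le_card_edgeSet_add_one
  -- A connected graph has at least as many edges as `S` has elements, so that `g` is a bijection.
  have hbij := hinj.bijective_of_nat_card_le (by omega)
  have hcard' := Nat.card_eq_of_bijective g hbij
  refine ⟨?_, ?_, SimpleGraph.isTree_iff_connected_and_card.2 ⟨hconn, ?_⟩⟩
  · intro e he w hw
    obtain ⟨a, hga⟩ := hbij.2 ⟨e, he⟩
    have h1 := hj a
    rw [hga] at h1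
    have := hends _ _ _ _ _ h1 hw
    rw [Sym2.eq_iff] at this
    rcases this with ⟨h1, h2⟩ | ⟨h1, h2⟩ <;> exact hne a (h1.trans h2.symm)
  · intro e he e' he' w z hw hw'
    obtain ⟨a, hga⟩ := hbij.2 ⟨e, he⟩
    obtain ⟨b, hgb⟩ := hbij.2 ⟨e', he'⟩
    have h1 := hj a
    have h2 := hj b
    rw [hga] at h1
    rw [hgb] at h2
    have hab : a = b := Subtype.ext <| by
      rw [ha a, ha b, hends _ _ _ _ _ h1 hw, hends _ _ _ _ _ h2 hw']
    rw [← hab, hga] at hgb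
    exact congrArg Subtype.val hgb
  · rw [← hG]
    omega

/-! ### Connectedness of the 1-skeleton -/

namespace TetGluing

variable {K : Type*} {T : TetGluing K} {S : Set T.Simplex}

/-- The image in the glued complex of the vertex `a` of the tetrahedron `t`. -/
def vertexImage (T : TetGluing K) (t : K) (a : Fin 4) : {v : T.Simplex // v.dim = 0} :=
  ⟨T.image (localVertex t a), dim_localVertex _ _ _⟩

theorem vertexImage_eq_of_carries {t t' : K} {a : Fin 4} {A : Finset (Fin 4)}
    {p : Equiv.Perm (Fin 4)} (h : T.Carries A t t' p) (ha : a ∈ A) :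
    T.vertexImage t a = T.vertexImage t' (p a) := by
  refine Subtype.ext (image_eq_iff.2 ⟨p, h.mono (by simpa [localVertex] using ha), ?_⟩)
  simp [localVertex]

/-- An edge of the glued complex determines the unordered pair of its ends. -/
theorem EdgeJoins.ends_eq {e : T.Simplex} {u v u' v' : {v : T.Simplex // v.dim = 0}}
    (h : T.EdgeJoins e u v) (h' : T.EdgeJoins e u' v') : s(u, v) = s(u', v') := by
  obtain ⟨t, a, b, hab, rfl, hu, hv⟩ := h
  obtain ⟨t', a', b', -, he, hu', hv'⟩ := h'
  obtain rfl : u = T.vertexImage t a := Subtype.ext hu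
  obtain rfl : v = T.vertexImage t b := Subtype.ext hv
  obtain rfl : u' = T.vertexImage t' a' := Subtype.ext hu'
  obtain rfl : v' = T.vertexImage t' b' := Subtype.ext hv'
  obtain ⟨q, hq, hmap⟩ := image_eq_iff.1 he
  simp only [localEdge, Finset.map_insert, Finset.map_singleton,
    Equiv.coe_toEmbedding] at hq hmap
  rw [vertexImage_eq_of_carries hq (show a ∈ _ by simp),
    vertexImage_eq_of_carries hq (show b ∈ _ by simp)]
  have hne : q a ≠ q b := fun h => hab (q.injective h)
  have h0 : q a ∈ ({a', b'} : Finset (Fin 4)) := by simp [← hmap]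
  have h1 : q b ∈ ({a', b'} : Finset (Fin 4)) := by simp [← hmap]
  simp only [Finset.mem_insert, Finset.mem_singleton] at h0 h1
  rcases h0 with h0 | h0 <;> rcases h1 with h1 | h1
  · exact absurd (h0.trans h1.symm) hne
  · rw [h0, h1]
  · rw [h0, h1, Sym2.eq_swap]
  · exact absurd (h0.trans h1.symm) hne

theorem DualJoins.symm {Δ : T.Simplex} {t t' : K} (h : T.DualJoins Δ t t') :
    T.DualJoins Δ t' t := by
  obtain ⟨i, p, hp, rfl⟩ := h
  exact ⟨p i, p⁻¹, T.adj_symm _ _ _ _ hp, T.image_localTriangle_eq hp⟩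

/-- The graph on the vertices of `T` defined by a set of edges. -/
def edgeGraph (T : TetGluing K) (E : Set T.Simplex) : SimpleGraph {v : T.Simplex // v.dim = 0} :=
  SimpleGraph.fromRel fun u v => ∃ e ∈ E, T.EdgeJoins e u v

theorem EdgeJoins.reachable {E : Set T.Simplex} {e : T.Simplex}
    {u v : {v : T.Simplex // v.dim = 0}} (h : T.EdgeJoins e u v) (he : e ∈ E) :
    (T.edgeGraph E).Reachable u v := by
  by_cases huv : u = v
  · rw [huv]
  · exact SimpleGraph.Adj.reachable
      ((SimpleGraph.fromRel_adj _ _ _).2 ⟨huv, .inl ⟨e, he, h⟩⟩)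

theorem edgeJoins_localEdge (t : K) {a b : Fin 4} (hab : a ≠ b) :
    T.EdgeJoins (T.image (localEdge t a b)) (T.vertexImage t a) (T.vertexImage t b) :=
  ⟨t, a, b, hab, rfl, rfl, rfl⟩

/-- The 1-skeleton is connected, because the tree of tetrahedra is. -/
theorem reachable_edgeGraph_all (hS : T.IsSpanningTreeOfTetrahedra S)
    (u v : {v : T.Simplex // v.dim = 0}) : (T.edgeGraph {c | c.dim = 1}).Reachable u v := by
  have hsame : ∀ t a b, (T.edgeGraph {c | c.dim = 1}).Reachable (T.vertexImage t a)
      (T.vertexImage t b) := by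
    intro t a b
    by_cases hab : a = b
    · rw [hab]
    · exact (edgeJoins_localEdge t hab).reachable (dim_localEdge _ _ hab)
  have hjoin : ∀ {Δ t t'}, T.DualJoins Δ t t' → ∀ a b,
      (T.edgeGraph {c | c.dim = 1}).Reachable (T.vertexImage t a) (T.vertexImage t' b) := by
    rintro Δ t t' ⟨i, p, hp, -⟩ a b
    have h : T.vertexImage t (i + 1) = T.vertexImage t' ((p * 1) (i + 1)) :=
      vertexImage_eq_of_carries (A := {i}ᶜ) (.cross .refl (by simp) hp) (by simp)
    exact (hsame t a (i + 1)).trans (h ▸ hsame t' _ b)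
  obtain ⟨u, hu⟩ := u
  obtain ⟨v, hv⟩ := v
  obtain ⟨x, rfl⟩ := exists_image_eq u
  obtain ⟨y, rfl⟩ := exists_image_eq v
  obtain ⟨a, ha⟩ := eq_localVertex hu
  obtain ⟨b, hb⟩ := eq_localVertex hv
  have hu' : (⟨T.image x, hu⟩ : {v : T.Simplex // v.dim = 0}) = T.vertexImage x.tet a :=
    Subtype.ext (congrArg T.image ha)
  have hv' : (⟨T.image y, hv⟩ : {v : T.Simplex // v.dim = 0}) = T.vertexImage y.tet b :=
    Subtype.ext (congrArg T.image hb)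
  rw [hu', hv']
  obtain ⟨w⟩ := hS.tree.isTree.connected.preconnected x.tet y.tet
  clear ha hb hu' hv' hu hv
  generalize x.tet = t at w
  generalize y.tet = t' at w
  induction w generalizing a with
  | nil => exact hsame _ _ _
  | @cons t₁ t₂ t₃ hadj _ ih =>
    refine SimpleGraph.Reachable.trans ?_ (ih a)
    rw [SimpleGraph.fromRel_adj] at hadj
    obtain ⟨-, ⟨Δ, -, h⟩ | ⟨Δ, -, h⟩⟩ := hadj
    · exact hjoin h a a
    · exact hjoin h.symm a a

theorem side_subset_triangle (x : Flag K) {i j : Fin 4} (hi : i ≠ 3) (hj : j ≠ 3) :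
    (localEdge x.1 (x.2.1 i) (x.2.1 j)).verts ⊆ (localTriangle x.1 (x.2.1 3)).verts := by
  intro a ha
  simp only [localEdge, Finset.mem_insert, Finset.mem_singleton] at ha
  simp only [localTriangle, Finset.mem_compl, Finset.mem_singleton]
  rcases ha with rfl | rfl
  · exact flag_ne x hi
  · exact flag_ne x hj

/-- Removing a free edge of a triangle keeps the graph connected, since the two other sides of the
triangle join the ends of the edge. -/
theorem IsFreeFace.reachable {R : Set T.Simplex} {σ τ : T.Simplex} (h : T.IsFreeFace R σ τ)
    {E : Set T.Simplex} (hE : ∀ e, e.dim = 1 → T.IsFace e τ → e ∈ E)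
    (hconn : ∀ u v, (T.edgeGraph E).Reachable u v) (u v : {v : T.Simplex // v.dim = 0}) :
    (T.edgeGraph (E \ {σ})).Reachable u v := by
  obtain ⟨x, rfl, rfl⟩ := exists_flag_of_isFace h.dim_small h.dim_big h.once.isFace
  have hside : ∀ i j : Fin 4, i ≠ 3 → j = 2 → i ≠ j →
      T.image (localEdge x.1 (x.2.1 i) (x.2.1 j)) ∈ E \ {T.image (flagEdge x)} := by
    intro i j hi hj hij
    have hsub := side_subset_triangle x hi (by rw [hj]; decide : j ≠ 3)
    refine ⟨hE _ (dim_localEdge _ _ (flag_ne x hij))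
      ⟨localEdge x.1 (x.2.1 i) (x.2.1 j), localTriangle x.1 (x.2.1 3), rfl, hsub, rfl, rfl⟩,
      fun heq => ?_⟩
    have := h.once.eq (x := localEdge x.1 (x.2.1 i) (x.2.1 j)) (x' := flagEdge x) rfl hsub heq rfl
      (flagEdge_subset_iff.2 (.inr rfl)) rfl
    have hmem : x.2.1 2 ∈ (flagEdge x).verts := by
      rw [← this, hj]
      simp [localEdge]
    simp [flagEdge, localEdge] at hmem
  have hkey : ∀ e ∈ E, ∀ u v, T.EdgeJoins e u v →
      (T.edgeGraph (E \ {T.image (flagEdge x)})).Reachable u v := by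
    intro e he u v huv
    by_cases heσ : e = T.image (flagEdge x)
    · have h02 := (edgeJoins_localEdge (T := T) x.1
        (flag_ne x (show (0 : Fin 4) ≠ 2 by decide))).reachable
        (hside 0 2 (by decide) rfl (by decide))
      have h12 := (edgeJoins_localEdge (T := T) x.1
        (flag_ne x (show (1 : Fin 4) ≠ 2 by decide))).reachable
        (hside 1 2 (by decide) rfl (by decide))
      have h01 := h02.trans h12.symm
      rw [heσ] at huv
      have hends := huv.ends_eq (edgeJoins_localEdge (T := T) x.1
        (flag_ne x (show (0 : Fin 4) ≠ 1 by decide)))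
      rcases Sym2.eq_iff.1 hends with ⟨rfl, rfl⟩ | ⟨rfl, rfl⟩
      · exact h01
      · exact h01.symm
    · exact huv.reachable ⟨he, heσ⟩
  obtain ⟨w⟩ := hconn u v
  induction w with
  | nil => exact .rfl
  | cons hadj _ ih =>
    refine SimpleGraph.Reachable.trans ?_ ih
    obtain ⟨-, ⟨e, he, h⟩ | ⟨e, he, h⟩⟩ := (SimpleGraph.fromRel_adj _ _ _).1 hadj
    · exact hkey e he _ _ h
    · exact (hkey e he _ _ h).symm

/-! ### Sequences of free faces -/

/-- The triangles in `S`, together with the first `k` triangles of the sequence `big`. -/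
def gluedBefore (S : Set T.Simplex) {n : ℕ} (big : Fin n → T.Simplex) (k : ℕ) : Set T.Simplex :=
  S ∪ big '' {r | r.1 < k}

theorem image_lt_zero {α : Type*} {n : ℕ} (f : Fin n → α) : f '' {r | r.1 < 0} = ∅ := by simp

theorem image_lt_succ {α : Type*} {n : ℕ} (f : Fin n → α) (s : Fin n) :
    f '' {r | r.1 < s.1 + 1} = insert (f s) (f '' {r | r.1 < s.1}) := by
  rw [← Set.image_insert_eq]
  congr 1
  ext r
  simp only [Set.mem_ofPred_eq, Set.mem_insert_iff, Fin.ext_iff]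
  omega

theorem image_lt_length {α : Type*} {n : ℕ} (f : Fin n → α) :
    f '' {r | r.1 < n} = Set.range f := by
  simp

theorem gluedBefore_zero {n : ℕ} (big : Fin n → T.Simplex) : gluedBefore S big 0 = S := by
  rw [gluedBefore, image_lt_zero, Set.union_empty]

theorem gluedBefore_succ {n : ℕ} (big : Fin n → T.Simplex) (s : Fin n) :
    gluedBefore S big (s.1 + 1) = insert (big s) (gluedBefore S big s.1) := by
  rw [gluedBefore, image_lt_succ, Set.union_insert, gluedBefore]

/-- The common combinatorial content of a local construction and of a collapsing sequence: an
enumeration `big` of the triangles that are not in `S`, and for each of them an edge `small s` that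
is a free face of it once the previous triangles have been removed. -/
structure FreeSequence (T : TetGluing K) (S : Set T.Simplex) where
  length : ℕ
  small : Fin length → T.Simplex
  big : Fin length → T.Simplex
  free : ∀ s, T.IsFreeFace (gluedBefore S big s.1) (small s) (big s)
  exhaust : ∀ τ : T.Simplex, τ.dim = 2 → τ ∈ S ∪ Set.range big

namespace FreeSequence

variable (D : T.FreeSequence S)

/-- A removed edge is not a face of the triangles that remain. -/
theorem not_isFace {r : Fin D.length} {k : ℕ} (hr : r.1 < k) {τ : T.Simplex} (hτ : τ.dim = 2)
    (hτk : τ ∉ gluedBefore S D.big k) : ¬ T.IsFace (D.small r) τ := by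
  intro h
  refine hτk (.inr ⟨r, hr, ((D.free r).free τ hτ ?_ h).symm⟩)
  rintro (hS | ⟨s, hs, rfl⟩)
  · exact hτk (.inl hS)
  · exact hτk (.inr ⟨s, lt_trans hs hr, rfl⟩)

theorem small_ne {r s : Fin D.length} (h : r < s) : D.small r ≠ D.small s := fun heq =>
  D.not_isFace h (D.free s).dim_big (D.free s).notMem (heq ▸ (D.free s).once.isFace)

theorem small_injective : Function.Injective D.small := by
  intro r s h
  rcases lt_trichotomy r s with hrs | hrs | hrs
  · exact absurd h (D.small_ne hrs)
  · exact hrs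
  · exact absurd h.symm (D.small_ne hrs)

/-- The edges that remain after `k` steps still connect all the vertices. -/
theorem reachable (hS : T.IsSpanningTreeOfTetrahedra S) (k : ℕ) (hk : k ≤ D.length) :
    ∀ u v, (T.edgeGraph ({c | c.dim = 1} \ D.small '' {r | r.1 < k})).Reachable u v := by
  induction k with
  | zero =>
    rw [image_lt_zero, Set.sdiff_empty]
    exact reachable_edgeGraph_all hS
  | succ k ih =>
    have hset : {c : T.Simplex | c.dim = 1} \ D.small '' {r | r.1 < k + 1} =
        ({c | c.dim = 1} \ D.small '' {r | r.1 < k}) \ {D.small ⟨k, hk⟩} := by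
      rw [image_lt_succ D.small ⟨k, hk⟩, Set.sdiff_sdiff, Set.union_singleton]
    rw [hset]
    refine (D.free ⟨k, hk⟩).reachable ?_ (ih (by omega))
    rintro e he hface
    refine ⟨he, ?_⟩
    rintro ⟨r, hr, rfl⟩
    exact D.not_isFace hr (D.free ⟨k, hk⟩).dim_big (D.free ⟨k, hk⟩).notMem hface

/-- The edges that are never removed. -/
def remainingEdges : Set T.Simplex := {c | c.dim = 1} \ Set.range D.small

theorem isSpanningTreeOfEdges [Finite K] (hT : T.IsClosed)
    (hS : T.IsSpanningTreeOfTetrahedra S) : T.IsSpanningTreeOfEdges D.remainingEdges := by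
  refine ⟨fun e he => he.1, isSpanningTreeOf_of_card (fun e u v u' v' h h' => h.ends_eq h') ?_ ?_⟩
  · have hconn := D.reachable hS D.length le_rfl
    rw [image_lt_length] at hconn
    obtain ⟨t⟩ := hS.tree.isTree.connected.nonempty
    have : Nonempty {v : T.Simplex // v.dim = 0} := ⟨T.vertexImage t 0⟩
    exact ⟨hconn⟩
  · have hS' : Nat.card S + 1 ≤ Nat.card K :=
      hS.tree.card_add_one_le (fun _ _ _ h => h.symm) hS.interior
    have htri : Nat.card {c : T.Simplex // c.dim = 2} ≤ Nat.card S + D.length := by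
      have := Nat.card_le_card_of_injective (Set.inclusion (fun c hc => D.exhaust c hc :
        {c : T.Simplex | c.dim = 2} ⊆ S ∪ Set.range D.big)) (Set.inclusion_injective _)
      refine this.trans ((Set.ncard_union_le _ _).trans ?_)
      have h2 := Finite.card_range_le D.big
      rw [Nat.card_eq_fintype_card (α := Fin _), Fintype.card_fin] at h2
      exact Nat.add_le_add_left h2 _
    have hedge : Nat.card D.remainingEdges + D.length ≤ Nat.card {c : T.Simplex // c.dim = 1} := by
      have hsub : Set.range D.small ⊆ {c | c.dim = 1} := by
        rintro _ ⟨s, rfl⟩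
        exact (D.free s).dim_small
      have h1 := Set.ncard_sdiff_add_ncard_of_subset hsub
      have h2 : (Set.range D.small).ncard = D.length := by
        rw [← Set.image_univ, Set.ncard_image_of_injective _ D.small_injective, Set.ncard_univ,
          Nat.card_eq_fintype_card, Fintype.card_fin]
      rw [h2] at h1
      exact h1.le
    have h1 := card_edges_le hT
    have h2 := two_mul_card_le_card_triangles hT
    omega

end FreeSequence

/-! ### Local constructions as sequences of free faces -/

theorem IsGluingStep.le {G G' : TetGluing K} {e : G.Simplex} (h : G.IsGluingStep e G') :
    G.Le G' := by
  obtain ⟨t, t', i, a, b, p, -, -, -, -, hn, hn', -, -, -, -, h3⟩ := h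
  intro u j y hy
  rw [h3 u j, hy]
  · rintro ⟨⟩
    rw [hn] at hy
    cases hy
  · rintro ⟨⟩
    rw [hn'] at hy
    cases hy

/-- A gluing made in a local construction is never undone. -/
theorem LocalConstruction.stage_le {T₀ : TetGluing K} (L : LocalConstruction T₀ T)
    (s : Fin (L.length + 1)) : (L.stage s).Le T := by
  induction s using Fin.reverseInduction with
  | last =>
    rw [L.finish]
    exact fun _ _ _ h => h
  | cast s ih => exact fun t i y h => ih t i y ((L.step s).le t i y h)

/-- The triangles of `T` that are already glued in `G`. -/
def gluedTriangles (T G : TetGluing K) : Set T.Simplex :=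
  {τ | ∃ t i, G.adj t i ≠ none ∧ T.image (localTriangle t i) = τ}

theorem Le.eq_restrict {G : TetGluing K} (h : G.Le T) :
    G = T.restrict (gluedTriangles T G) := by
  ext1
  funext t i
  by_cases hti : G.adj t i = none
  · rw [hti, eq_comm, Option.eq_none_iff_forall_ne_some]
    intro y hy
    obtain ⟨⟨u, j, huj, himg⟩, -⟩ := restrict_adj_eq_some.1 hy
    rcases image_localTriangle_eq_iff.1 himg with ⟨rfl, rfl⟩ | ⟨p, hp, rfl⟩
    · exact huj hti
    · obtain ⟨z, hz⟩ := Option.ne_none_iff_exists'.1 huj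
      have hz' := h _ _ _ hz
      rw [hp, Option.some.injEq] at hz'
      subst hz'
      rw [G.adj_symm _ _ _ _ hz] at hti
      cases hti
  · obtain ⟨y, hy⟩ := Option.ne_none_iff_exists'.1 hti
    have hmem : T.image (localTriangle t i) ∈ gluedTriangles T G := ⟨t, i, hti, rfl⟩
    exact hy.trans (restrict_adj_eq_some.2 ⟨hmem, h _ _ _ hy⟩).symm

theorem gluedTriangles_restrict (hT : T.IsClosed) {R : Set T.Simplex}
    (hR : ∀ τ ∈ R, τ.dim = 2) : gluedTriangles T (T.restrict R) = R := by
  ext τ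
  constructor
  · rintro ⟨t, i, h, rfl⟩
    by_contra hmem
    exact h ((restrict_adj_eq_none hT).2 hmem)
  · intro hτ
    obtain ⟨l, rfl⟩ := exists_image_eq τ
    obtain ⟨i, hi⟩ := eq_localTriangle (hR _ hτ)
    have himg := congrArg T.image hi
    refine ⟨l.tet, i, fun h => (restrict_adj_eq_none hT).1 h ?_, himg.symm⟩
    rwa [← himg]

theorem IsSpanningTreeOfTetrahedra.dim_eq_two (hS : T.IsSpanningTreeOfTetrahedra S)
    {τ : T.Simplex} (hτ : τ ∈ S) : τ.dim = 2 := by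
  obtain ⟨t, t', i, p, -, rfl⟩ := hS.interior τ hτ
  exact dim_localTriangle _ _ _

theorem restrict_eq_self {R : Set T.Simplex} (hR : ∀ τ : T.Simplex, τ.dim = 2 → τ ∈ R) :
    T.restrict R = T := by
  ext1
  funext t i
  simp [restrict, hR _ (dim_localTriangle T t i)]

namespace FreeSequence

/-- The local construction in which the triangles `big s` are glued one after the other, around the
edges `small s`. -/
noncomputable def toLocalConstruction [Finite K] (hT : T.IsClosed) (D : T.FreeSequence S) :
    LocalConstruction (T.restrict S) T where
  length := D.length
  stage s := T.restrict (gluedBefore S D.big s.1)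
  edge s := ((D.free s).exists_isGluingStep hT).choose
  start := by rw [Fin.val_zero, gluedBefore_zero]
  finish := restrict_eq_self fun τ hτ => by
    rw [Fin.val_last, gluedBefore, image_lt_length]
    exact D.exhaust τ hτ
  step s := by
    rw [Fin.val_succ, gluedBefore_succ]
    exact ((D.free s).exists_isGluingStep hT).choose_spec.1

theorem toLocalConstruction_edge [Finite K] (hT : T.IsClosed) (D : T.FreeSequence S)
    (s : Fin D.length) (l : LocalSimplex K) :
    ((D.toLocalConstruction hT).stage s.castSucc).image l = (D.toLocalConstruction hT).edge s ↔
      T.image l = D.small s :=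
  ((D.free s).exists_isGluingStep hT).choose_spec.2 l

theorem toLocalConstruction_triangle [Finite K] (hT : T.IsClosed) (D : T.FreeSequence S)
    (s : Fin D.length) (t : K) (i : Fin 4) :
    (((D.toLocalConstruction hT).stage s.castSucc).adj t i = none ∧
      ((D.toLocalConstruction hT).stage s.succ).adj t i ≠ none) ↔
      T.image (localTriangle t i) = D.big s := by
  change (T.restrict (gluedBefore S D.big s.1)).adj t i = none ∧
    (T.restrict (gluedBefore S D.big (s.1 + 1))).adj t i ≠ none ↔ _
  rw [Ne, restrict_adj_eq_none hT, restrict_adj_eq_none hT, not_not, gluedBefore_succ]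
  constructor
  · rintro ⟨h1, h2⟩
    exact h2.resolve_right h1
  · intro h
    rw [h]
    exact ⟨(D.free s).notMem, .inl rfl⟩

theorem toLocalConstruction_injective [Finite K] (hT : T.IsClosed) :
    Function.Injective (toLocalConstruction (S := S) hT) := by
  -- The edges and the triangles can be read off the local construction.
  let read (L : LocalConstruction (T.restrict S) T) :
      Σ n, Fin n → Set T.Simplex × Set T.Simplex :=
    ⟨L.length, fun s =>
      ({σ | ∃ l, (L.stage s.castSucc).image l = L.edge s ∧ T.image l = σ},
        {τ | ∃ t i, ((L.stage s.castSucc).adj t i = none ∧ (L.stage s.succ).adj t i ≠ none) ∧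
          T.image (localTriangle t i) = τ})⟩
  have hread : ∀ D : T.FreeSequence S, read (D.toLocalConstruction hT) =
      ⟨D.length, fun s => ({D.small s}, {D.big s})⟩ := by
    intro D
    change (⟨D.length, _⟩ : Σ n, Fin n → Set T.Simplex × Set T.Simplex) = _
    congr 1
    funext s
    refine Prod.ext ?_ ?_
    · ext σ
      constructor
      · rintro ⟨l, hl, rfl⟩
        exact (D.toLocalConstruction_edge hT s l).1 hl
      · rintro rfl
        obtain ⟨l, hl⟩ := exists_image_eq (D.small s)
        exact ⟨l, (D.toLocalConstruction_edge hT s l).2 hl, hl⟩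
    · ext τ
      constructor
      · rintro ⟨t, i, h, rfl⟩
        exact (D.toLocalConstruction_triangle hT s t i).1 h
      · rintro rfl
        obtain ⟨l, hl⟩ := exists_image_eq (D.big s)
        obtain ⟨i, hi⟩ := eq_localTriangle (hl ▸ (D.free s).dim_big)
        rw [hi] at hl
        exact ⟨l.tet, i, (D.toLocalConstruction_triangle hT s _ i).2 hl, hl⟩
  intro D D' h
  have h' := congrArg read h
  rw [hread, hread] at h'
  obtain ⟨n, small, big, free, exhaust⟩ := D
  obtain ⟨n', small', big', free', exhaust'⟩ := D'
  obtain ⟨rfl, h'⟩ := Sigma.mk.inj h'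
  have h' := eq_of_heq h'
  obtain rfl : small = small' := funext fun s =>
    Set.singleton_injective (congrArg Prod.fst (congrFun h' s))
  obtain rfl : big = big' := funext fun s =>
    Set.singleton_injective (congrArg Prod.snd (congrFun h' s))
  rfl

theorem exists_isFreeFace_of_localConstruction [Finite K] (hT : T.IsClosed)
    (hS : T.IsSpanningTreeOfTetrahedra S) (L : LocalConstruction (T.restrict S) T) :
    ∃ small big : Fin L.length → T.Simplex,
      (∀ s, L.stage s = T.restrict (gluedBefore S big s.1)) ∧
      (∀ s, T.IsFreeFace (gluedBefore S big s.1) (small s) (big s)) ∧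
      ∀ s l, (L.stage s.castSucc).image l = L.edge s ↔ T.image l = small s := by
  choose small big hfree hnext hedge using fun s =>
    (L.step s).exists_isFreeFace hT (L.stage_le _).eq_restrict (L.stage_le _)
  have hS2 : ∀ k, ∀ τ ∈ gluedBefore S big k, τ.dim = 2 := by
    rintro k τ (hτ | ⟨r, -, rfl⟩)
    · exact hS.dim_eq_two hτ
    · exact (hfree r).dim_big
  have hstage : ∀ s, L.stage s = T.restrict (gluedBefore S big s.1) := by
    intro s
    induction s using Fin.induction with
    | zero => rw [L.start, Fin.val_zero, gluedBefore_zero]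
    | succ s ih =>
      rw [hnext s, ih, gluedTriangles_restrict hT (hS2 _), Fin.val_succ, gluedBefore_succ]
      rfl
  refine ⟨small, big, hstage, fun s => ?_, hedge⟩
  have := hfree s
  rwa [hstage, gluedTriangles_restrict hT (hS2 _)] at this

theorem toLocalConstruction_surjective [Finite K] (hT : T.IsClosed)
    (hS : T.IsSpanningTreeOfTetrahedra S) :
    Function.Surjective (toLocalConstruction (S := S) hT) := by
  intro L
  have key := exists_isFreeFace_of_localConstruction hT hS L
  obtain ⟨n, stage, edge, start, finish, step⟩ := L
  obtain ⟨small, big, hstage, hfree', hedge⟩ : ∃ small big : Fin n → T.Simplex,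
      (∀ s, stage s = T.restrict (gluedBefore S big s.1)) ∧
      (∀ s : Fin n, T.IsFreeFace (gluedBefore S big s.1) (small s) (big s)) ∧
      ∀ s l, (stage s.castSucc).image l = edge s ↔ T.image l = small s := key
  obtain rfl : stage = fun s => T.restrict (gluedBefore S big s.1) := funext hstage
  have hexhaust : ∀ τ : T.Simplex, τ.dim = 2 → τ ∈ S ∪ Set.range big := by
    intro τ hτ
    obtain ⟨l, rfl⟩ := exists_image_eq τ
    obtain ⟨i, hi⟩ := eq_localTriangle hτ
    rw [hi]
    by_contra hmem
    refine hT l.tet i ?_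
    rw [← image_lt_length] at hmem
    have := (restrict_adj_eq_none hT).2 hmem
    exact (congrArg (fun G : TetGluing K => G.adj l.tet i) finish).symm.trans this
  let D : T.FreeSequence S := ⟨n, small, big, hfree', hexhaust⟩
  obtain rfl : (D.toLocalConstruction hT).edge = edge := by
    funext s
    obtain ⟨l, hl⟩ := exists_image_eq (small s)
    exact ((D.toLocalConstruction_edge hT s l).2 hl).symm.trans ((hedge s l).2 hl)
  exact ⟨D, rfl⟩

/-! ### Collapsing sequences as sequences of free faces -/

/-- The collapsing sequence that removes the triangles `big s` together with their free faces
`small s`. -/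
noncomputable def toCollapsingSequence [Finite K] (hT : T.IsClosed)
    (hS : T.IsSpanningTreeOfTetrahedra S) (D : T.FreeSequence S) : T.CollapsingSequence S where
  tree := D.remainingEdges
  isTree := D.isSpanningTreeOfEdges hT hS
  length := D.length
  stage s := T.twoComplex S \ (D.small '' {r | r.1 < s.1} ∪ D.big '' {r | r.1 < s.1})
  small := D.small
  big := D.big
  start := by rw [Fin.val_zero, image_lt_zero, image_lt_zero, Set.union_empty, Set.sdiff_empty]
  finish := by
    rw [Fin.val_last, image_lt_length, image_lt_length]
    ext c
    constructor
    · rintro ⟨⟨hdim, hcS⟩, hc⟩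
      have h2 : c.dim ≠ 2 := by
        intro h2
        rcases D.exhaust c h2 with h | h
        · exact hcS h
        · exact hc (.inr h)
      have : c.dim = 0 ∨ c.dim = 1 := by omega
      rcases this with h | h
      · exact .inl h
      · exact .inr ⟨h, fun hs => hc (.inl hs)⟩
    · intro hc
      have hdim : c.dim ≤ 1 := by
        rcases hc with h | h
        · exact h.le.trans zero_le_one
        · exact h.1.le
      refine ⟨⟨by omega, fun h => ?_⟩, ?_⟩
      · have := hS.dim_eq_two h
        omega
      · rintro (⟨s, rfl⟩ | ⟨s, rfl⟩)
        · rcases hc with h | h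
          · have h1 := (D.free s).dim_small
            have h0 : (D.small s).dim = 0 := h
            omega
          · exact h.2 ⟨s, rfl⟩
        · have := (D.free s).dim_big
          omega
  step s := by
    have h1 := (D.free s).dim_small
    have h2 := (D.free s).dim_big
    have hnot := (D.free s).notMem
    refine ⟨⟨⟨by omega, fun h => ?_⟩, ?_⟩, ⟨⟨by omega, fun h => hnot (.inl h)⟩, ?_⟩, by omega,
      (D.free s).once, ?_, ?_⟩
    · have := hS.dim_eq_two h
      omega
    · rintro (⟨r, hr, h⟩ | ⟨r, -, h⟩)
      · exact D.small_ne hr h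
      · have := (D.free r).dim_big
        rw [h] at this
        omega
    · rintro (⟨r, -, h⟩ | h)
      · have := (D.free r).dim_small
        rw [h] at this
        omega
      · exact hnot (.inr h)
    · rintro ρ ⟨⟨hdim, hρS⟩, hρ⟩ hface
      by_cases hρ2 : ρ.dim = 2
      · refine .inr ((D.free s).free ρ hρ2 ?_ hface)
        rintro (h | h)
        · exact hρS h
        · exact hρ (.inr h)
      · exact .inl (hface.eq_of_dim_le (by omega)).symm
    · rw [Fin.val_succ, image_lt_succ, image_lt_succ, Set.sdiff_sdiff]
      congr 1
      ext c
      simp only [Set.mem_union, Set.mem_insert_iff, Set.mem_singleton_iff, Fin.val_castSucc]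
      tauto

theorem toCollapsingSequence_injective [Finite K] (hT : T.IsClosed)
    (hS : T.IsSpanningTreeOfTetrahedra S) :
    Function.Injective (toCollapsingSequence hT hS) := by
  let read (C : T.CollapsingSequence S) : Σ n, Fin n → T.Simplex × T.Simplex :=
    ⟨C.length, fun s => (C.small s, C.big s)⟩
  intro D D' h
  have h' := congrArg read h
  obtain ⟨n, small, big, free, exhaust⟩ := D
  obtain ⟨n', small', big', free', exhaust'⟩ := D'
  obtain ⟨rfl, h'⟩ := Sigma.mk.inj h'
  have h' := eq_of_heq h'
  obtain rfl : small = small' := funext fun s => congrArg Prod.fst (congrFun h' s)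
  obtain rfl : big = big' := funext fun s => congrArg Prod.snd (congrFun h' s)
  rfl

theorem toCollapsingSequence_surjective [Finite K] (hT : T.IsClosed)
    (hS : T.IsSpanningTreeOfTetrahedra S) :
    Function.Surjective (toCollapsingSequence hT hS) := by
  rintro ⟨tree, isTree, n, stage, small, big, start, finish, step⟩
  have hlow : ∀ s, T.edgeComplex tree ⊆ stage s := by
    intro s
    induction s using Fin.reverseInduction with
    | last => exact finish.ge
    | cast s ih =>
      have := (step s).eq_diff
      exact fun c hc => ((this ▸ ih hc : c ∈ stage s.castSucc \ {small s, big s})).1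
  have hupp : ∀ s, stage s ⊆ T.twoComplex S := by
    intro s
    induction s using Fin.induction with
    | zero => exact start.le
    | succ s ih =>
      rw [(step s).eq_diff]
      exact fun c hc => ih hc.1
  -- The vertices are never removed, so that every collapse removes a triangle.
  have hdim : ∀ s, (small s).dim = 1 ∧ (big s).dim = 2 := by
    intro s
    have h1 := (step s).dim_eq
    have h2 : (big s).dim ≤ 2 := (hupp _ (step s).mem_simplex).1
    have h3 : (small s).dim ≠ 0 := by
      intro h
      have hmem : small s ∈ stage s.succ := hlow _ (.inl h)
      rw [(step s).eq_diff] at hmem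
      exact hmem.2 (.inl rfl)
    omega
  have hstage : ∀ s, stage s =
      T.twoComplex S \ (small '' {r | r.1 < s.1} ∪ big '' {r | r.1 < s.1}) := by
    intro s
    induction s using Fin.induction with
    | zero =>
      rw [start, Fin.val_zero, image_lt_zero, image_lt_zero, Set.union_empty, Set.sdiff_empty]
    | succ s ih =>
      rw [(step s).eq_diff, ih, Fin.val_succ, image_lt_succ, image_lt_succ, Set.sdiff_sdiff]
      congr 1
      ext c
      simp only [Set.mem_union, Set.mem_insert_iff, Set.mem_singleton_iff, Fin.val_castSucc]
      tauto
  have htriangle : ∀ s, ∀ τ : T.Simplex, τ.dim = 2 → τ ∉ gluedBefore S big s.1 → τ ∈ stage s := by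
    intro s τ hτ h
    rw [hstage]
    refine ⟨⟨hτ.le, fun h' => h (.inl h')⟩, ?_⟩
    rintro (⟨r, -, rfl⟩ | h')
    · rw [(hdim r).1] at hτ
      omega
    · exact h (.inr h')
  have hfree : ∀ s, T.IsFreeFace (gluedBefore S big s.1) (small s) (big s) := by
    intro s
    refine ⟨(hdim s).1, (hdim s).2, ?_, (step s).once, ?_⟩
    · have hmem := (step s).mem_simplex
      rw [hstage] at hmem
      rintro (h | h)
      · exact hmem.1.2 h
      · exact hmem.2 (.inr h)
    · intro ρ hρ hρR hface
      rcases (step s).free ρ (htriangle s.castSucc ρ hρ hρR) hface with h | h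
      · have := (hdim s).1
        rw [← h] at this
        omega
      · exact h
  refine ⟨⟨n, small, big, hfree, ?_⟩, ?_⟩
  · intro τ hτ
    rw [← image_lt_length]
    by_contra hmem
    have h := htriangle (Fin.last n) τ hτ hmem
    rw [finish] at h
    rcases h with h | h
    · have h0 : τ.dim = 0 := h
      omega
    · have := isTree.dim_eq_one τ h
      omega
  · obtain rfl : stage = fun s : Fin (n + 1) =>
      T.twoComplex S \ (small '' {r | r.1 < s.1} ∪ big '' {r | r.1 < s.1}) := funext hstage
    have htree : {c : T.Simplex | c.dim = 1} \ Set.range small = tree := by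
      have hfin := finish
      simp only [Fin.val_last, image_lt_length] at hfin
      ext c
      constructor
      · rintro ⟨h1, hc⟩
        have h1 : c.dim = 1 := h1
        have : c ∈ T.edgeComplex tree := by
          rw [← hfin]
          refine ⟨⟨by omega, fun h => ?_⟩, ?_⟩
          · have := hS.dim_eq_two h
            omega
          · rintro (h | ⟨r, rfl⟩)
            · exact hc h
            · have := (hdim r).2
              omega
        refine this.resolve_left fun h => ?_
        have h0 : c.dim = 0 := h
        omega
      · intro hc
        refine ⟨isTree.dim_eq_one c hc, fun h => ?_⟩
        have : c ∈ T.edgeComplex tree := .inr hc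
        rw [← hfin] at this
        exact this.2 (.inl h)
    subst htree
    rfl

theorem corresponds [Finite K] (hT : T.IsClosed) (hS : T.IsSpanningTreeOfTetrahedra S)
    (D : T.FreeSequence S) :
    Corresponds (D.toLocalConstruction hT) (D.toCollapsingSequence hT hS) :=
  ⟨rfl, fun s => ⟨fun t i h h' => (D.toLocalConstruction_triangle hT s t i).1 ⟨h, h'⟩,
    fun l h => (D.toLocalConstruction_edge hT s l).1 h⟩⟩

end FreeSequence

end TetGluing

theorem mainTheorem3 {K : Type*} [Finite K] (T : TetGluing K) (hT : T.IsClosed)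
    (S : Set T.Simplex) (hS : T.IsSpanningTreeOfTetrahedra S) :
    ∃ Φ : TetGluing.LocalConstruction (T.restrict S) T ≃ T.CollapsingSequence S,
      ∀ L, TetGluing.Corresponds L (Φ L) := by
  let e := Equiv.ofBijective (TetGluing.FreeSequence.toLocalConstruction (S := S) hT)
    ⟨TetGluing.FreeSequence.toLocalConstruction_injective hT,
      TetGluing.FreeSequence.toLocalConstruction_surjective hT hS⟩
  let e' := Equiv.ofBijective (TetGluing.FreeSequence.toCollapsingSequence hT hS)
    ⟨TetGluing.FreeSequence.toCollapsingSequence_injective hT hS,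
      TetGluing.FreeSequence.toCollapsingSequence_surjective hT hS⟩
  refine ⟨e.symm.trans e', fun L => ?_⟩
  obtain ⟨D, rfl⟩ := e.surjective L
  rw [Equiv.trans_apply, Equiv.symm_apply_apply]
  exact D.corresponds hT hS
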